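/- **Setting.** Let $\mathbb R^4$ carry its standard flat connection $D$ and a parallel volume form $[\cdot,\cdot,\cdot,\cdot]$, and let $M\subset\mathbb R^4$ be a smooth immersed surface. For a local tangent frame $u=\{X_1,X_2\}$ put $G_u(Y,Z)=\frac12\big([X_1,X_2,D_YX_1,D_ZX_2]+[X_1,X_2,D_ZX_1,D_YX_2]\big)$ and $\Delta(u)=G_u(X_1,X_1)G_u(X_2,X_2)-G_u(X_1,X_2)^2$. Assume that $M$ is non-degenerate, i.e. $\Delta(u)\neq0$, and let $g=\Delta(u)^{-1/3}G_u$ be its affine metric (independent of $u$). Let $\epsilon\in\{1,-1\}$ ($\epsilon=1$ if $g$ is definite, $\epsilon=-1$ if it is indefinite). Let $\{X_1,X_2\}$ be a smooth tangent frame on an open set $U\subset M$ with $g(X_1,X_1)=\epsilon$, $g(X_1,X_2)=0$, $g(X_2,X_2)=1$, and let $\{\xi_1,\xi_2\}$ be a smooth basis over $U$ of a transversal plane bundle $\sigma$. Decompose, for tangent fields $X,Y$, $$D_XY=\nabla_XY+h^1(X,Y)\xi_1+h^2(X,Y)\xi_2,\qquad D_X\xi_i=-S_iX+\tau_i^1(X)\xi_1+\tau_i^2(X)\xi_2,$$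 with $\nabla_XY$ and $S_iX$ tangent, and write $\nabla_{X_i}X_j=\Gamma_{ij}^1X_1+\Gamma_{ij}^2X_2$, $S_iX_j=\lambda_{ij}^1X_1+\lambda_{ij}^2X_2$. Assume that $[X_1,X_2,\xi_1,\xi_2]=1$ and $$h^1(X_1,X_1)=1,\ h^1(X_1,X_2)=0,\ h^1(X_2,X_2)=-\epsilon,\quad h^2(X_1,X_1)=0,\ h^2(X_1,X_2)=1,\ h^2(X_2,X_2)=0,$$ and that $\sigma$ is the (Nomizu–Vrancken) affine normal plane bundle, i.e., with $\nabla g(X,Y,Z)=(\nabla_Xg)(Y,Z)$, $$\epsilon\nabla g(X_i,X_1,X_1)+\nabla g(X_i,X_2,X_2)=0\ (i=1,2),$$ $$\nabla g(X_2,X_1,X_1)+\nabla g(X_1,X_2,X_1)=0,\quad \nabla g(X_1,X_2,X_2)+\nabla g(X_2,X_1,X_2)=0.$$ Call such $(U,X_1,X_2,\xi_1,\xi_2)$ an adapted frame on $U$. Put $C^i(X,Y,Z)=(\nabla_Xh^i)(Y,Z)+\tau_1^i(X)h^1(Y,Z)+\tau_2^i(X)h^2(Y,Z)$ and $$L=\begin{pmatrix}\lambda_{11}^1-\lambda_{21}^2&-\epsilon\lambda_{11}^2-\lambda_{21}^1\\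 \lambda_{12}^1-\lambda_{22}^2&-\epsilon\lambda_{12}^2-\lambda_{22}^1\end{pmatrix},$$ $$F=\begin{pmatrix}3C^1(X_1,X_1,X_2)-\epsilon C^1(X_2,X_2,X_2)&\epsilon C^1(X_1,X_1,X_1)-3C^1(X_1,X_2,X_2)\\3C^2(X_1,X_1,X_2)-\epsilon C^2(X_2,X_2,X_2)&\epsilon C^2(X_1,X_1,X_1)-3C^2(X_1,X_2,X_2)\end{pmatrix},$$ let $H$ be the $4\times2$ matrix formed by the rows of $L$ followed by the rows of $F$ (so $\ker H=\ker L\cap\ker F\subset\mathbb R^2$), and $$G_1=\Gamma_{22}^2-\epsilon\Gamma_{11}^2+\tau_1^1(X_2)-\epsilon\tau_1^2(X_1),\qquad G_2=\Gamma_{11}^1-\epsilon\Gamma_{22}^1-\tau_2^2(X_1)+\tau_1^2(X_2).$$ A smooth function $\eta$ on an open set is called an angle of a pair $(A,B)\ne(0,0)$ of functions if $A\sin\eta=B\cos\eta$ when $\epsilon=1$ (i.e. $\tan\eta=B/A$), and, when $\epsilon=-1$, $\tanh\eta=B/A$ where $|B|<|A|$ and $\tanh\eta=A/B$ where $|A|<|B|$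 (a pair with $|A|=|B|$ has no angle if $\epsilon=-1$). Consider the equations $$d\eta(X_1)+\epsilon G_1=0,\qquad d\eta(X_2)-G_2=0.\tag{$*$}$$ **Theorem.** (1) Let an adapted frame on $U$ be given and suppose that $M$ is Lagrangian over $U$ for a parallel symplectic form $\Omega$ of $\mathbb R^4$. Then the affine normal plane bundle is $\Omega$-Lagrangian, and $\Omega\wedge\Omega=c\,[\cdot,\cdot,\cdot,\cdot]$ for a constant $c\neq0$. Moreover $\Omega(X_1,\xi_2)=\Omega(X_2,\xi_1)=:A$, $\Omega(X_1,\xi_1)=-\epsilon\,\Omega(X_2,\xi_2)=:B$, the vector $[A,B]^t$ belongs to $\ker H$, the pair $(A,B)$ has a smooth angle near every point of $U$, and every smooth angle $\eta$ of $(A,B)$ on an open subset of $U$ satisfies $(*)$. (2) Conversely, let $W\subset M$ be open and connected (for instance $W=M$ for connected $M$), and suppose that every point of $W$ has an open neighbourhood $U$ with an adapted frame such that, on $U$, $\operatorname{rank}H=1$ and $\ker H$ is spanned by a vector $[A,B]^t$ that has a smooth angle $\eta$ satisfying $(*)$. Then there is a parallel symplectic form $\Omega$ of $\mathbb R^4$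 for which $M$ is Lagrangian over $W$. -/

import Mathlib

open scoped Manifold ContDiff Matrix

noncomputable section

namespace AffineSurface

/-- The ambient space. It is used only as a four-dimensional affine space: neither its norm nor its
inner product enters any definition. -/
abbrev R4 : Type := EuclideanSpace ℝ (Fin 4)

/-- (Not necessarily smooth) tangent vector fields on the surface `M`. -/
abbrev VField (M : Type*) [TopologicalSpace M] [ChartedSpace (EuclideanSpace ℝ (Fin 2)) M] : Type _ :=
  (p : M) → TangentSpace (𝓡 2) p

/-- A vector field is smooth on the set `U`. -/
def SmoothFieldOn {M : Type*} [TopologicalSpace M] [ChartedSpace (EuclideanSpace ℝ (Fin 2)) M]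
    [IsManifold (𝓡 2) ∞ M] (X : VField M) (U : Set M) : Prop :=
  ContMDiffOn (𝓡 2) (𝓡 2).tangent ∞ (fun p => (⟨p, X p⟩ : TangentBundle (𝓡 2) M)) U

/-! ### Parallel forms on `ℝ⁴` -/

/-- A parallel (constant coefficient) symplectic form on `ℝ⁴`. -/
def IsSymplectic (Ω : LinearMap.BilinForm ℝ R4) : Prop :=
  Ω.IsAlt ∧ Ω.Nondegenerate

/-- A plane `W` of `ℝ⁴` is `Ω`-Lagrangian. -/
def IsLagrangianPlane (Ω : LinearMap.BilinForm ℝ R4) (W : Submodule ℝ R4) : Prop :=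
  Module.finrank ℝ W = 2 ∧ ∀ v ∈ W, ∀ w ∈ W, Ω v w = 0

/-- The value of the `4`-form `Ω ∧ Ω`. -/
def wedgeSq (Ω : LinearMap.BilinForm ℝ R4) (v : Fin 4 → R4) : ℝ :=
  2 * (Ω (v 0) (v 1) * Ω (v 2) (v 3) - Ω (v 0) (v 2) * Ω (v 1) (v 3)
    + Ω (v 0) (v 3) * Ω (v 1) (v 2))

/-- The `k`-th coordinate of `v` in the basis `b`, by Cramer's rule. -/
def coord (vol : R4 [⋀^Fin 4]→ₗ[ℝ] ℝ) (b : Fin 4 → R4) (k : Fin 4) (v : R4) : ℝ :=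
  vol (Function.update b k v) / vol b

/-- The numbers `coord vol b k v` are indeed the coordinates of `v` with respect to `b`. -/
theorem sum_coord_smul (vol : R4 [⋀^Fin 4]→ₗ[ℝ] ℝ) (b : Fin 4 → R4) (hb : vol b ≠ 0) (v : R4) :
    ∑ k, coord vol b k v • b k = v := by
  have hli : LinearIndependent ℝ b := by
    by_contra h
    exact hb (vol.map_linearDependent b h)
  have hspan : ⊤ ≤ Submodule.span ℝ (Set.range b) := by
    rw [hli.span_eq_top_of_card_eq_finrank (by simp)]
  obtain ⟨c, rfl⟩ := (Submodule.mem_span_range_iff_exists_fun ℝ).1 (hspan (Submodule.mem_top (x := v)))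
  refine Finset.sum_congr rfl fun k _ => ?_
  congr 1
  have h1 : vol (Function.update b k (∑ i, c i • b i)) = c k * vol b := by
    rw [AlternatingMap.map_update_sum, Finset.sum_eq_single k]
    · rw [AlternatingMap.map_update_smul, Function.update_eq_self, smul_eq_mul]
    · intro j _ hjk
      rw [AlternatingMap.map_update_smul, AlternatingMap.map_update_self _ _ hjk.symm, smul_zero]
    · simp
  rw [coord, h1, mul_div_cancel_right₀ _ hb]

/-- The real cube root, also of negative numbers. -/
def cbrt (x : ℝ) : ℝ := Real.sign x * |x| ^ (1 / 3 : ℝ)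

section Surface

variable {M : Type*} [TopologicalSpace M] [ChartedSpace (EuclideanSpace ℝ (Fin 2)) M]

/-- The derivative `D_v Y` at `p` of a function `Y` on `M` with values in a vector space `E`, in the
direction of the tangent vector `v`. For `E = ℝ⁴` it is the standard connection along the surface. -/
def dirD {E : Type*} [NormedAddCommGroup E] [NormedSpace ℝ E] (Y : M → E) (p : M) :
    TangentSpace (𝓡 2) p →L[ℝ] E :=
  mfderiv (𝓡 2) 𝓘(ℝ, E) Y p

/-- The tangent vector field `X`, seen as an `ℝ⁴`-valued function through the immersion `f`. -/
def push (f : M → R4) (X : VField M) (p : M) : R4 := dirD f p (X p)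

/-- `f` is a smooth immersion of the surface `M` in `ℝ⁴`. -/
def IsImmersedSurface (f : M → R4) : Prop :=
  ContMDiff (𝓡 2) 𝓘(ℝ, R4) ∞ f ∧ ∀ p, Function.Injective (dirD f p)

/-- The tangent plane of the immersed surface at `f p`. -/
def tangentPlane (f : M → R4) (p : M) : Submodule ℝ R4 :=
  LinearMap.range (dirD f p : TangentSpace (𝓡 2) p →ₗ[ℝ] R4)

/-- The part of the immersed surface over `U` is `Ω`-Lagrangian. -/
def IsLagrangianOn (Ω : LinearMap.BilinForm ℝ R4) (f : M → R4) (U : Set M) : Prop :=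
  ∀ p ∈ U, IsLagrangianPlane Ω (tangentPlane f p)

/-! ### The affine metric

Indices run over `Fin 2`, so that `X 0`, `X 1` are the fields usually called `X₁`, `X₂`. -/

/-- `G_u(y, z) = ([X₁, X₂, D_y X₁, D_z X₂] + [X₁, X₂, D_z X₁, D_y X₂]) / 2` for `u = (X₁, X₂)`. -/
def formG (f : M → R4) (vol : R4 [⋀^Fin 4]→ₗ[ℝ] ℝ) (X : Fin 2 → VField M) (p : M)
    (y z : TangentSpace (𝓡 2) p) : ℝ :=
  (vol ![push f (X 0) p, push f (X 1) p,
      dirD (push f (X 0)) p y, dirD (push f (X 1)) p z]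
    + vol ![push f (X 0) p, push f (X 1) p,
      dirD (push f (X 0)) p z, dirD (push f (X 1)) p y]) / 2

/-- `Δ(u)`. -/
def discr (f : M → R4) (vol : R4 [⋀^Fin 4]→ₗ[ℝ] ℝ) (X : Fin 2 → VField M) (p : M) : ℝ :=
  formG f vol X p (X 0 p) (X 0 p) * formG f vol X p (X 1 p) (X 1 p)
    - formG f vol X p (X 0 p) (X 1 p) ^ 2

/-- The affine (Burstin–Mayer) metric `g = Δ(u)^(-1/3) G_u`. It does not depend on the local frame
`u`; here it is computed with the frame `X` at hand. -/
def metric (f : M → R4) (vol : R4 [⋀^Fin 4]→ₗ[ℝ] ℝ) (X : Fin 2 → VField M) (p : M)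
    (y z : TangentSpace (𝓡 2) p) : ℝ :=
  formG f vol X p y z / cbrt (discr f vol X p)

/-! ### The structure of the surface with respect to a transversal plane bundle spanned by `ξ` -/

/-- The frame `(X₁, X₂, ξ₁, ξ₂)` of `ℝ⁴` along the surface. -/
def frame (f : M → R4) (X : Fin 2 → VField M) (ξ : Fin 2 → M → R4) (p : M) : Fin 4 → R4 :=
  ![push f (X 0) p, push f (X 1) p, ξ 0 p, ξ 1 p]

/-- The coordinate along `X_k` of a vector of `ℝ⁴`. -/
def tcoord (f : M → R4) (vol : R4 [⋀^Fin 4]→ₗ[ℝ] ℝ) (X : Fin 2 → VField M) (ξ : Fin 2 → M → R4)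
    (p : M) (k : Fin 2) (v : R4) : ℝ :=
  coord vol (frame f X ξ p) (![0, 1] k) v

/-- The coordinate along `ξ_k` of a vector of `ℝ⁴`. -/
def ncoord (f : M → R4) (vol : R4 [⋀^Fin 4]→ₗ[ℝ] ℝ) (X : Fin 2 → VField M) (ξ : Fin 2 → M → R4)
    (p : M) (k : Fin 2) (v : R4) : ℝ :=
  coord vol (frame f X ξ p) (![2, 3] k) v

/-- The induced connection: `∇_Y Z` is the tangent part of `D_Y Z`. -/
def nabla (f : M → R4) (vol : R4 [⋀^Fin 4]→ₗ[ℝ] ℝ) (X : Fin 2 → VField M) (ξ : Fin 2 → M → R4)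
    (Y Z : VField M) : VField M := fun p =>
  tcoord f vol X ξ p 0 (dirD (push f Z) p (Y p)) • X 0 p
    + tcoord f vol X ξ p 1 (dirD (push f Z) p (Y p)) • X 1 p

/-- `h^i(Y, Z)`: the coefficients of `D_Y Z` along `ξ_i`. -/
def hform (f : M → R4) (vol : R4 [⋀^Fin 4]→ₗ[ℝ] ℝ) (X : Fin 2 → VField M) (ξ : Fin 2 → M → R4)
    (i : Fin 2) (Y Z : VField M) (p : M) : ℝ :=
  ncoord f vol X ξ p i (dirD (push f Z) p (Y p))

/-- `Γ_{ij}^k`, where `∇_{X_i} X_j = Γ_{ij}^1 X₁ + Γ_{ij}^2 X₂`. -/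
def Gam (f : M → R4) (vol : R4 [⋀^Fin 4]→ₗ[ℝ] ℝ) (X : Fin 2 → VField M) (ξ : Fin 2 → M → R4)
    (i j k : Fin 2) (p : M) : ℝ :=
  tcoord f vol X ξ p k (dirD (push f (X j)) p (X i p))

/-- `τ_i^j(Y)`, where `D_Y ξ_i = -S_i Y + τ_i^1(Y) ξ₁ + τ_i^2(Y) ξ₂`. -/
def tau (f : M → R4) (vol : R4 [⋀^Fin 4]→ₗ[ℝ] ℝ) (X : Fin 2 → VField M) (ξ : Fin 2 → M → R4)
    (i j : Fin 2) (Y : VField M) (p : M) : ℝ :=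
  ncoord f vol X ξ p j (dirD (ξ i) p (Y p))

/-- `λ_{ij}^k`, where `S_i X_j = λ_{ij}^1 X₁ + λ_{ij}^2 X₂`. -/
def lam (f : M → R4) (vol : R4 [⋀^Fin 4]→ₗ[ℝ] ℝ) (X : Fin 2 → VField M) (ξ : Fin 2 → M → R4)
    (i j k : Fin 2) (p : M) : ℝ :=
  -tcoord f vol X ξ p k (dirD (ξ i) p (X j p))

/-- `(∇g)(Y, Z, W) = (∇_Y g)(Z, W)`. -/
def nablaMetric (f : M → R4) (vol : R4 [⋀^Fin 4]→ₗ[ℝ] ℝ) (X : Fin 2 → VField M)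
    (ξ : Fin 2 → M → R4) (Y Z W : VField M) (p : M) : ℝ :=
  dirD (fun q => metric f vol X q (Z q) (W q)) p (Y p)
    - metric f vol X p (nabla f vol X ξ Y Z p) (W p)
    - metric f vol X p (Z p) (nabla f vol X ξ Y W p)

/-- The cubic form
`C^i(Y, Z, W) = (∇_Y h^i)(Z, W) + τ_1^i(Y) h^1(Z, W) + τ_2^i(Y) h^2(Z, W)`. -/
def cubic (f : M → R4) (vol : R4 [⋀^Fin 4]→ₗ[ℝ] ℝ) (X : Fin 2 → VField M) (ξ : Fin 2 → M → R4)
    (i : Fin 2) (Y Z W : VField M) (p : M) : ℝ :=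
  dirD (hform f vol X ξ i Z W) p (Y p)
    - hform f vol X ξ i (nabla f vol X ξ Y Z) W p
    - hform f vol X ξ i Z (nabla f vol X ξ Y W) p
    + tau f vol X ξ 0 i Y p * hform f vol X ξ 0 Z W p
    + tau f vol X ξ 1 i Y p * hform f vol X ξ 1 Z W p

/-- The matrix `L`. -/
def matL (ε : ℝ) (f : M → R4) (vol : R4 [⋀^Fin 4]→ₗ[ℝ] ℝ) (X : Fin 2 → VField M)
    (ξ : Fin 2 → M → R4) (p : M) : Matrix (Fin 2) (Fin 2) ℝ :=
  !![lam f vol X ξ 0 0 0 p - lam f vol X ξ 1 0 1 p,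
      -ε * lam f vol X ξ 0 0 1 p - lam f vol X ξ 1 0 0 p;
    lam f vol X ξ 0 1 0 p - lam f vol X ξ 1 1 1 p,
      -ε * lam f vol X ξ 0 1 1 p - lam f vol X ξ 1 1 0 p]

/-- The matrix `F`. -/
def matF (ε : ℝ) (f : M → R4) (vol : R4 [⋀^Fin 4]→ₗ[ℝ] ℝ) (X : Fin 2 → VField M)
    (ξ : Fin 2 → M → R4) (p : M) : Matrix (Fin 2) (Fin 2) ℝ :=
  !![3 * cubic f vol X ξ 0 (X 0) (X 0) (X 1) p - ε * cubic f vol X ξ 0 (X 1) (X 1) (X 1) p,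
      ε * cubic f vol X ξ 0 (X 0) (X 0) (X 0) p - 3 * cubic f vol X ξ 0 (X 0) (X 1) (X 1) p;
    3 * cubic f vol X ξ 1 (X 0) (X 0) (X 1) p - ε * cubic f vol X ξ 1 (X 1) (X 1) (X 1) p,
      ε * cubic f vol X ξ 1 (X 0) (X 0) (X 0) p - 3 * cubic f vol X ξ 1 (X 0) (X 1) (X 1) p]

/-- The matrix `H`: the rows of `L` followed by the rows of `F`. Its kernel in `ℝ²` is
`ker L ∩ ker F`. -/
def matH (ε : ℝ) (f : M → R4) (vol : R4 [⋀^Fin 4]→ₗ[ℝ] ℝ) (X : Fin 2 → VField M)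
    (ξ : Fin 2 → M → R4) (p : M) : Matrix (Fin 2 ⊕ Fin 2) (Fin 2) ℝ :=
  Matrix.fromRows (matL ε f vol X ξ p) (matF ε f vol X ξ p)

/-- `G₁ = Γ_{22}^2 - ε Γ_{11}^2 + τ_1^1(X₂) - ε τ_1^2(X₁)`. -/
def fnG₁ (ε : ℝ) (f : M → R4) (vol : R4 [⋀^Fin 4]→ₗ[ℝ] ℝ) (X : Fin 2 → VField M)
    (ξ : Fin 2 → M → R4) (p : M) : ℝ :=
  Gam f vol X ξ 1 1 1 p - ε * Gam f vol X ξ 0 0 1 p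
    + tau f vol X ξ 0 0 (X 1) p - ε * tau f vol X ξ 0 1 (X 0) p

/-- `G₂ = Γ_{11}^1 - ε Γ_{22}^1 - τ_2^2(X₁) + τ_1^2(X₂)`. -/
def fnG₂ (ε : ℝ) (f : M → R4) (vol : R4 [⋀^Fin 4]→ₗ[ℝ] ℝ) (X : Fin 2 → VField M)
    (ξ : Fin 2 → M → R4) (p : M) : ℝ :=
  Gam f vol X ξ 0 0 0 p - ε * Gam f vol X ξ 1 1 0 p
    - tau f vol X ξ 1 1 (X 0) p + tau f vol X ξ 0 1 (X 1) p

/-- The angle `t` of the direction `(a, b) ≠ 0`: for `ε = 1`, `tan t = b / a` (with `cos t = 0` when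
`a = 0`); for `ε = -1`, `tanh t = b / a` if `|b| < |a|` and `tanh t = a / b` if `|a| < |b|` (so the
null directions `|a| = |b|` have no angle). -/
def IsAngle (ε a b t : ℝ) : Prop :=
  (a ≠ 0 ∨ b ≠ 0) ∧
    ((ε = 1 ∧ a * Real.sin t = b * Real.cos t) ∨
      (ε = -1 ∧ (a * Real.sinh t = b * Real.cosh t ∨ a * Real.cosh t = b * Real.sinh t)))

/-- `dη(X₁) + ε G₁ = 0` and `dη(X₂) - G₂ = 0` at `p`. -/
def EtaEquations (ε : ℝ) (f : M → R4) (vol : R4 [⋀^Fin 4]→ₗ[ℝ] ℝ) (X : Fin 2 → VField M)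
    (ξ : Fin 2 → M → R4) (η : M → ℝ) (p : M) : Prop :=
  dirD η p (X 0 p) + ε * fnG₁ ε f vol X ξ p = 0 ∧ dirD η p (X 1 p) - fnG₂ ε f vol X ξ p = 0

end Surface

/-- On the open set `U` of the surface, which is non-degenerate there, `X` is a smooth
`g`-orthonormal tangent frame, and `ξ` is the associated normalized basis of the affine normal plane
bundle. -/
structure IsAffineNormalFrame {M : Type*} [TopologicalSpace M]
    [ChartedSpace (EuclideanSpace ℝ (Fin 2)) M] [IsManifold (𝓡 2) ∞ M]
    (ε : ℝ) (f : M → R4) (vol : R4 [⋀^Fin 4]→ₗ[ℝ] ℝ) (U : Set M)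
    (X : Fin 2 → VField M) (ξ : Fin 2 → M → R4) : Prop where
  isOpen : IsOpen U
  smooth_X : ∀ i, SmoothFieldOn (X i) U
  smooth_ξ : ∀ i, ContMDiffOn (𝓡 2) 𝓘(ℝ, R4) ∞ (ξ i) U
  -- non-degeneracy and orthonormality
  discr_ne : ∀ p ∈ U, discr f vol X p ≠ 0
  metric₁₁ : ∀ p ∈ U, metric f vol X p (X 0 p) (X 0 p) = ε
  metric₁₂ : ∀ p ∈ U, metric f vol X p (X 0 p) (X 1 p) = 0
  metric₂₂ : ∀ p ∈ U, metric f vol X p (X 1 p) (X 1 p) = 1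
  -- normalization of `ξ`
  vol_eq : ∀ p ∈ U, vol (frame f X ξ p) = 1
  h1_11 : ∀ p ∈ U, hform f vol X ξ 0 (X 0) (X 0) p = 1
  h1_12 : ∀ p ∈ U, hform f vol X ξ 0 (X 0) (X 1) p = 0
  h1_22 : ∀ p ∈ U, hform f vol X ξ 0 (X 1) (X 1) p = -ε
  h2_11 : ∀ p ∈ U, hform f vol X ξ 1 (X 0) (X 0) p = 0
  h2_12 : ∀ p ∈ U, hform f vol X ξ 1 (X 0) (X 1) p = 1
  h2_22 : ∀ p ∈ U, hform f vol X ξ 1 (X 1) (X 1) p = 0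
  -- the transversal bundle is equiaffine
  equiaffine₁ : ∀ p ∈ U, ε * nablaMetric f vol X ξ (X 0) (X 0) (X 0) p
    + nablaMetric f vol X ξ (X 0) (X 1) (X 1) p = 0
  equiaffine₂ : ∀ p ∈ U, ε * nablaMetric f vol X ξ (X 1) (X 0) (X 0) p
    + nablaMetric f vol X ξ (X 1) (X 1) (X 1) p = 0
  -- it is the affine normal plane bundle
  normal₁ : ∀ p ∈ U, nablaMetric f vol X ξ (X 1) (X 0) (X 0) p
    + nablaMetric f vol X ξ (X 0) (X 1) (X 0) p = 0
  normal₂ : ∀ p ∈ U, nablaMetric f vol X ξ (X 0) (X 1) (X 1) p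
    + nablaMetric f vol X ξ (X 1) (X 0) (X 1) p = 0

/-- The fibre at `p` of the plane bundle spanned by `ξ₁`, `ξ₂`. -/
def normalPlane {M : Type*} (ξ : Fin 2 → M → R4) (p : M) : Submodule ℝ R4 :=
  Submodule.span ℝ {ξ 0 p, ξ 1 p}

end AffineSurface

end

/-! Everything is obtained by differentiating in the moving frame (X₁, X₂, ξ₁, ξ₂). Volume 1 of the
frame, the Codazzi equations of the flat connection and the conditions on the affine normal plane
are ten linear equations for the sixteen coefficients Γ, τ; six of them stay free
(`IsAffineNormalFrame.relations`).

For a Lagrangian surface, differentiating Ω(X₁, X₂) = 0 reduces the pairings of tangent with normal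
vectors to the two numbers A and B (`pairing_eq`). Differentiating those identities gives Ω(ξ₁, ξ₂)
= 0 and F[A, B]ᵗ = 0 (`algebraic_equations`), and differentiating Ω(ξ₁, ξ₂) = 0 gives L[A, B]ᵗ = 0.
On the frame Ω ∧ Ω takes the value 2(A² + εB²), so A² + εB² is a nonzero constant and (A, B) moves
on a conic. It therefore has an angle, whose derivative is the Wronskian of A and B divided by A² +
εB² (`dirD_angle`); computing the Wronskian modulo the kernel equations gives (*)
(`wronskian_pairing`).

Conversely, the kernel direction is that of (cos η, sin η), (cosh η, sinh η) or (sinh η, cosh η).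
With these functions as coefficients, a 2-form is written in the dual frame; the kernel equations
together with (*) make its derivative vanish (`dirD_pairForm`), so it is locally a constant
symplectic form, and it has no X₁, X₂ component. The hypothesis rank H = 1 enters twice: it prevents
a jump between the two hyperbolic pairs (`exists_local_lagrangian`), and it makes the symplectic
form of a Lagrangian piece unique up to a factor (`exists_smul_eq`), which lets the local forms be
glued over a connected set. -/

open scoped Topology

noncomputable section

namespace AffineSurface

/-! ### Calculus of vector-valued functions on the surface: product rules, commutators, locally
constant functions. -/

section Calculus

variable {M : Type*} [TopologicalSpace M] [ChartedSpace (EuclideanSpace ℝ (Fin 2)) M]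
  {E : Type*} [NormedAddCommGroup E] [NormedSpace ℝ E]
  {G : Type*} [NormedAddCommGroup G] [NormedSpace ℝ G]

theorem dirD_congr {F F' : M → E} {p : M} (h : F =ᶠ[𝓝 p] F') : dirD F p = dirD F' p :=
  h.mfderiv_eq

theorem dirD_congr_on {F F' : M → E} {U : Set M} (hU : IsOpen U) (h : ∀ q ∈ U, F q = F' q)
    {p : M} (hp : p ∈ U) : dirD F p = dirD F' p :=
  dirD_congr (Filter.eventually_of_mem (hU.mem_nhds hp) h)

theorem dirD_eq_zero_of_const_on {F : M → E} {U : Set M} (hU : IsOpen U) {c : E}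
    (h : ∀ q ∈ U, F q = c) {p : M} (hp : p ∈ U) : dirD F p = 0 := by
  rw [dirD_congr_on hU h hp]
  exact mfderiv_const

theorem mdifferentiableAt_of_contMDiffOn {F : M → E} {U : Set M} (hU : IsOpen U)
    (h : ContMDiffOn (𝓡 2) 𝓘(ℝ, E) ∞ F U) {p : M} (hp : p ∈ U) :
    MDifferentiableAt (𝓡 2) 𝓘(ℝ, E) F p :=
  ((h p hp).contMDiffAt (hU.mem_nhds hp)).mdifferentiableAt (by simp)

theorem dirD_comp {F : M → E} {g : E → G} {p : M} (hF : MDifferentiableAt (𝓡 2) 𝓘(ℝ, E) F p)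
    (hg : DifferentiableAt ℝ g (F p)) (v : TangentSpace (𝓡 2) p) :
    dirD (fun q => g (F q)) p v = fderiv ℝ g (F p) (dirD F p v) := by
  have := mfderiv_comp (I := 𝓡 2) (I' := 𝓘(ℝ, E)) (I'' := 𝓘(ℝ, G)) p
    hg.mdifferentiableAt hF
  unfold dirD
  have h2 : (fun q => g (F q)) = g ∘ F := rfl
  rw [h2, this, mfderiv_eq_fderiv]
  rfl

theorem dirD_comp_clm {F : M → E} (g : E →L[ℝ] G) {p : M}
    (hF : MDifferentiableAt (𝓡 2) 𝓘(ℝ, E) F p) (v : TangentSpace (𝓡 2) p) :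
    dirD (fun q => g (F q)) p v = g (dirD F p v) := by
  rw [dirD_comp hF g.differentiableAt, g.fderiv]

theorem dirD_prodMk {F : M → E} {F' : M → G} {p : M}
    (hF : MDifferentiableAt (𝓡 2) 𝓘(ℝ, E) F p) (hF' : MDifferentiableAt (𝓡 2) 𝓘(ℝ, G) F' p)
    (v : TangentSpace (𝓡 2) p) :
    dirD (fun q => (F q, F' q)) p v = (dirD F p v, dirD F' p v) := by
  have h := hF.prodMk_space hF'
  have h1 := dirD_comp_clm (ContinuousLinearMap.fst ℝ E G) h v
  have h2 := dirD_comp_clm (ContinuousLinearMap.snd ℝ E G) h v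
  exact Prod.ext h1.symm h2.symm

theorem dirD_comp₂ {F : M → E} {F' : M → G} {K : Type*} [NormedAddCommGroup K] [NormedSpace ℝ K]
    (g : E →L[ℝ] G →L[ℝ] K) {p : M}
    (hF : MDifferentiableAt (𝓡 2) 𝓘(ℝ, E) F p) (hF' : MDifferentiableAt (𝓡 2) 𝓘(ℝ, G) F' p)
    (v : TangentSpace (𝓡 2) p) :
    dirD (fun q => g (F q) (F' q)) p v = g (dirD F p v) (F' p) + g (F p) (dirD F' p v) := by
  have h := dirD_comp (g := fun x : E × G => g x.1 x.2) (hF.prodMk_space hF')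
    (g.isBoundedBilinearMap.differentiableAt _) v
  rw [h, dirD_prodMk hF hF']
  have := (g.isBoundedBilinearMap.hasFDerivAt (F p, F' p)).fderiv
  rw [this]
  simp [IsBoundedBilinearMap.deriv, add_comm]

theorem dirD_add {F F' : M → E} {p : M} (hF : MDifferentiableAt (𝓡 2) 𝓘(ℝ, E) F p)
    (hF' : MDifferentiableAt (𝓡 2) 𝓘(ℝ, E) F' p) (v : TangentSpace (𝓡 2) p) :
    dirD (fun q => F q + F' q) p v = dirD F p v + dirD F' p v := by
  have h := dirD_comp_clm (ContinuousLinearMap.fst ℝ E E + ContinuousLinearMap.snd ℝ E E)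
    (hF.prodMk_space hF') v
  rw [dirD_prodMk hF hF'] at h
  exact h

theorem dirD_sum {ι : Type*} (s : Finset ι) {F : ι → M → E} {p : M}
    (hF : ∀ i ∈ s, MDifferentiableAt (𝓡 2) 𝓘(ℝ, E) (F i) p) (v : TangentSpace (𝓡 2) p) :
    MDifferentiableAt (𝓡 2) 𝓘(ℝ, E) (fun q => ∑ i ∈ s, F i q) p ∧
    dirD (fun q => ∑ i ∈ s, F i q) p v = ∑ i ∈ s, dirD (F i) p v := by
  classical
  induction s using Finset.induction_on with
  | empty =>
    simp only [Finset.sum_empty]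
    exact ⟨mdifferentiableAt_const, by
      rw [dirD_eq_zero_of_const_on isOpen_univ (c := (0 : E)) (fun _ _ => rfl) (Set.mem_univ p)]
      rfl⟩
  | insert a s ha ih =>
    obtain ⟨h1, h2⟩ := ih fun i hi => hF i (Finset.mem_insert_of_mem hi)
    have h0 := hF a (Finset.mem_insert_self a s)
    simp only [Finset.sum_insert ha]
    exact ⟨h0.add h1, by rw [dirD_add h0 h1, h2]⟩

theorem dirD_smul {a : M → ℝ} {F : M → E} {p : M} (ha : MDifferentiableAt (𝓡 2) 𝓘(ℝ, ℝ) a p)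
    (hF : MDifferentiableAt (𝓡 2) 𝓘(ℝ, E) F p) (v : TangentSpace (𝓡 2) p) :
    dirD (fun q => a q • F q) p v = dirD a p v • F p + a p • dirD F p v :=
  dirD_comp₂ (ContinuousLinearMap.lsmul ℝ ℝ) ha hF v

theorem mdifferentiableAt_smul {a : M → ℝ} {F : M → E} {p : M}
    (ha : MDifferentiableAt (𝓡 2) 𝓘(ℝ, ℝ) a p) (hF : MDifferentiableAt (𝓡 2) 𝓘(ℝ, E) F p) :
    MDifferentiableAt (𝓡 2) 𝓘(ℝ, E) (fun q => a q • F q) p :=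
  ha.smul hF

theorem mdifferentiableAt_add {F F' : M → E} {p : M}
    (hF : MDifferentiableAt (𝓡 2) 𝓘(ℝ, E) F p) (hF' : MDifferentiableAt (𝓡 2) 𝓘(ℝ, E) F' p) :
    MDifferentiableAt (𝓡 2) 𝓘(ℝ, E) (fun q => F q + F' q) p :=
  hF.add hF'

theorem dirD_mul {a b : M → ℝ} {p : M} (ha : MDifferentiableAt (𝓡 2) 𝓘(ℝ, ℝ) a p)
    (hb : MDifferentiableAt (𝓡 2) 𝓘(ℝ, ℝ) b p) (v : TangentSpace (𝓡 2) p) :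
    dirD (fun q => a q * b q) p v = dirD a p v * b p + a p * dirD b p v :=
  dirD_smul ha hb v

theorem contMDiffOn_comp {F : M → E} {g : E → G} {U : Set M}
    (hF : ContMDiffOn (𝓡 2) 𝓘(ℝ, E) ∞ F U) (hg : ∀ q ∈ U, ContDiffAt ℝ ∞ g (F q)) :
    ContMDiffOn (𝓡 2) 𝓘(ℝ, G) ∞ (fun q => g (F q)) U := fun q hq =>
  (hg q hq).contMDiffAt.comp_contMDiffWithinAt q (hF q hq)

variable [IsManifold (𝓡 2) ∞ M]

/-- The function is the fibre component of the tangent map of `F` composed with the section `X`. The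
tangent map costs one derivative, which is harmless at order ∞. -/
theorem contMDiffOn_dirD {F : M → E} {U : Set M} (hU : IsOpen U)
    (hF : ContMDiffOn (𝓡 2) 𝓘(ℝ, E) ∞ F U) {X : VField M} (hX : SmoothFieldOn X U) :
    ContMDiffOn (𝓡 2) 𝓘(ℝ, E) ∞ (fun p => dirD F p (X p)) U := by
  have : IsManifold (𝓡 2) 1 M := IsManifold.of_le (n := ∞) (by simp)
  have h1 := hF.contMDiffOn_tangentMapWithin (m := ∞) (by simp) hU.uniqueMDiffOn
  have h2 := h1.comp hX (fun p hp => hp)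
  have h3 := (contMDiff_snd_tangentBundle_modelSpace E 𝓘(ℝ, E) (n := ∞)).comp_contMDiffOn h2
  refine h3.congr fun p hp => ?_
  change mfderiv (𝓡 2) 𝓘(ℝ, E) F p (X p) = mfderivWithin (𝓡 2) 𝓘(ℝ, E) F U p (X p)
  rw [mfderivWithin_of_isOpen hU hp]

/-- A function is, near a point, a function of the coordinates. -/
theorem exists_chart_representation {F : M → E} {U : Set M} (hU : IsOpen U)
    (hF : ContMDiffOn (𝓡 2) 𝓘(ℝ, E) ∞ F U) {p : M} (hp : p ∈ U) :
    ∃ F' : EuclideanSpace ℝ (Fin 2) → E, F' = F ∘ (extChartAt (𝓡 2) p).symm ∧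
      (∀ᶠ x in 𝓝 (extChartAt (𝓡 2) p p), ContDiffAt ℝ ∞ F' x) ∧
      ∀ᶠ q in 𝓝 p, F q = F' (extChartAt (𝓡 2) p q) := by
  refine ⟨_, rfl, ?_, ?_⟩
  · have h1 : ∀ᶠ x in 𝓝 (extChartAt (𝓡 2) p p), x ∈ (extChartAt (𝓡 2) p).target :=
      (isOpen_extChartAt_target p).mem_nhds (mem_extChartAt_target p)
    have h2 : ∀ᶠ x in 𝓝 (extChartAt (𝓡 2) p p), (extChartAt (𝓡 2) p).symm x ∈ U := by
      have := continuousAt_extChartAt_symm (I := 𝓡 2) p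
      exact this.eventually_mem (hU.mem_nhds (by simpa using hp))
    filter_upwards [h1, h2] with x hx hxU
    rw [← contMDiffAt_iff_contDiffAt]
    have h3 := (contMDiffOn_extChartAt_symm (I := 𝓡 2) (n := ∞) p).contMDiffAt
      ((isOpen_extChartAt_target p).mem_nhds hx)
    exact ((hF _ hxU).contMDiffAt (hU.mem_nhds hxU)).comp x h3
  · filter_upwards [extChartAt_source_mem_nhds (I := 𝓡 2) p] with q hq
    rw [Function.comp_apply, (extChartAt (𝓡 2) p).left_inv hq]

/-- The commutator of two vector fields is a vector field: the operator `XY - YX` is the derivative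
in the direction of a tangent vector. -/
theorem exists_commutator {U : Set M} (hU : IsOpen U) {X Y : VField M} (hX : SmoothFieldOn X U)
    (hY : SmoothFieldOn Y U) {p : M} (hp : p ∈ U) :
    ∃ Z : TangentSpace (𝓡 2) p, ∀ F : M → E, ContMDiffOn (𝓡 2) 𝓘(ℝ, E) ∞ F U →
      dirD (fun q => dirD F q (Y q)) p (X p) - dirD (fun q => dirD F q (X q)) p (Y p)
        = dirD F p Z := by
  set φ := extChartAt (𝓡 2) p with hφ
  set V := U ∩ φ.source with hVdef
  have hV : IsOpen V := hU.inter (isOpen_extChartAt_source p)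
  have hpV : p ∈ V := ⟨hp, mem_extChartAt_source p⟩
  have hφs : ContMDiffOn (𝓡 2) 𝓘(ℝ, EuclideanSpace ℝ (Fin 2)) ∞ φ V :=
    ((contMDiffOn_extChartAt (I := 𝓡 2) (n := ∞) (x := p)).mono fun q hq => by
      simpa [hφ] using hq.2)
  -- In the chart, the iterated derivative splits into the second derivative of `F`, bilinear in the
  -- two directions, and a first-order term that contains the derivative of the components of the
  -- field.
  have haux : ∀ {Y' : VField M}, SmoothFieldOn Y' U →
      ∀ F : M → E, ContMDiffOn (𝓡 2) 𝓘(ℝ, E) ∞ F U → ∀ v : TangentSpace (𝓡 2) p,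
      dirD (fun q => dirD F q (Y' q)) p v =
        fderiv ℝ (fderiv ℝ (F ∘ φ.symm)) (φ p) (dirD φ p v) (dirD φ p (Y' p)) +
        fderiv ℝ (F ∘ φ.symm) (φ p) (dirD (fun q => dirD φ q (Y' q)) p v) := by
    intro Y' hY' F hF v
    obtain ⟨F', hF', hs, he⟩ := exists_chart_representation hU hF hp
    rw [← hF']
    have hφp : Filter.Tendsto φ (𝓝 p) (𝓝 (φ p)) := continuousAt_extChartAt p
    have he2 : ∀ᶠ q in 𝓝 p, dirD F q (Y' q) = fderiv ℝ F' (φ q) (dirD φ q (Y' q)) := by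
      filter_upwards [he.eventually_nhds, hφp.eventually hs, hV.mem_nhds hpV] with q h1 h2 h3
      rw [dirD_congr h1]
      exact dirD_comp (mdifferentiableAt_of_contMDiffOn hV hφs h3)
        (h2.differentiableAt (by simp)) _
    rw [dirD_congr he2]
    have hd : ContDiffAt ℝ ∞ (fderiv ℝ F') (φ p) :=
      hs.self_of_nhds.fderiv_right (m := ∞) (by simp)
    have hφd := mdifferentiableAt_of_contMDiffOn hV hφs hpV
    have hda : MDifferentiableAt (𝓡 2) 𝓘(ℝ, EuclideanSpace ℝ (Fin 2))
        (fun q => dirD φ q (Y' q)) p :=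
      mdifferentiableAt_of_contMDiffOn hV
        (contMDiffOn_dirD hV hφs (hY'.mono Set.inter_subset_left)) hpV
    have hdd : MDifferentiableAt (𝓡 2) 𝓘(ℝ, EuclideanSpace ℝ (Fin 2) →L[ℝ] E)
        (fun q => fderiv ℝ F' (φ q)) p :=
      (hd.differentiableAt (by simp)).mdifferentiableAt.comp p hφd
    refine (dirD_comp₂ (ContinuousLinearMap.id ℝ _) hdd hda v).trans ?_
    rw [dirD_comp hφd (hd.differentiableAt (by simp))]
    rfl
  have hinv := isInvertible_mfderiv_extChartAt (I := 𝓡 2) (mem_extChartAt_source (I := 𝓡 2) p)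
  obtain ⟨e, he⟩ := hinv
  -- The coordinate expression of the Lie bracket; it does not involve `F`. The chart's derivative
  -- is invertible, so it comes from a tangent vector.
  set w : EuclideanSpace ℝ (Fin 2) :=
    dirD (fun q => dirD φ q (Y q)) p (X p) - dirD (fun q => dirD φ q (X q)) p (Y p) with hw
  have hew : dirD φ p (e.symm w) = w :=
    (DFunLike.congr_fun he.symm (e.symm w)).trans (e.apply_symm_apply w)
  refine ⟨e.symm w, fun F hF => ?_⟩
  obtain ⟨F', hF', hs, hFe⟩ := exists_chart_representation hU hF hp
  rw [haux hX F hF, haux hY F hF, ← hF', dirD_congr hFe,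
    dirD_comp (mdifferentiableAt_of_contMDiffOn hV hφs hpV)
      (hs.self_of_nhds.differentiableAt (by simp)), hew, hw, map_sub]
  -- Symmetry cancels the two second-order terms, leaving the first-order ones.
  have hsymm : IsSymmSndFDerivAt ℝ F' (φ p) :=
    hs.self_of_nhds.isSymmSndFDerivAt (by
      rw [minSmoothness_of_isRCLikeNormedField]
      exact WithTop.coe_le_coe.2 (le_top : (2 : ℕ∞) ≤ ⊤))
  rw [hsymm.eq]
  abel

/-- A function with zero derivative is locally constant. -/
theorem eventually_eq_of_dirD_eq_zero {F : M → E} {U : Set M} (hU : IsOpen U)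
    (hF : ContMDiffOn (𝓡 2) 𝓘(ℝ, E) ∞ F U) (h0 : ∀ q ∈ U, dirD F q = 0) {p : M} (hp : p ∈ U) :
    ∀ᶠ q in 𝓝 p, F q = F p := by
  obtain ⟨F', hF', hs, he⟩ := exists_chart_representation hU hF hp
  set φ := extChartAt (𝓡 2) p with hφ
  have hz : ∀ᶠ x in 𝓝 (φ p), fderiv ℝ F' x = 0 := by
    have h1 : ∀ᶠ x in 𝓝 (φ p), x ∈ φ.target :=
      (isOpen_extChartAt_target p).mem_nhds (mem_extChartAt_target p)
    have h2 : ∀ᶠ x in 𝓝 (φ p), φ.symm x ∈ U := by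
      have := continuousAt_extChartAt_symm (I := 𝓡 2) p
      exact this.eventually_mem (hU.mem_nhds (by simpa using hp))
    filter_upwards [h1, h2] with x hx hxU
    have h3 := (contMDiffOn_extChartAt_symm (I := 𝓡 2) (n := ∞) p).contMDiffAt
      ((isOpen_extChartAt_target p).mem_nhds hx)
    have h4 := mfderiv_comp x (mdifferentiableAt_of_contMDiffOn hU hF hxU)
      (h3.mdifferentiableAt (by simp))
    rw [hF', ← mfderiv_eq_fderiv, h4]
    have h5 : mfderiv (𝓡 2) 𝓘(ℝ, E) F (φ.symm x) = 0 := h0 _ hxU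
    rw [h5]
    exact ContinuousLinearMap.zero_comp _
  obtain ⟨r, hr, hball⟩ := Metric.eventually_nhds_iff_ball.1 (hs.and hz)
  have hφp : Filter.Tendsto φ (𝓝 p) (𝓝 (φ p)) := continuousAt_extChartAt p
  filter_upwards [he, hφp.eventually (Metric.ball_mem_nhds _ hr)] with q h1 h2
  rw [h1, he.self_of_nhds]
  -- Zero derivative passes to the chart, where a ball is convex and the mean value inequality
  -- applies.
  refine (convex_ball (φ p) r).is_const_of_fderivWithin_eq_zero (𝕜 := ℝ)
    (fun x hx => ((hball x hx).1.differentiableAt (by simp)).differentiableWithinAt)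
    (fun x hx => ?_) h2 (Metric.mem_ball_self hr)
  rw [fderivWithin_of_isOpen Metric.isOpen_ball hx]
  exact (hball x hx).2

end Calculus

/-! ### The volume form and coordinates by Cramer's rule. -/

section LinearAlgebra

variable (vol : R4 [⋀^Fin 4]→ₗ[ℝ] ℝ)

/-- Every 4-form on ℝ⁴ is a constant times the determinant in a basis, and the determinant is
polynomial in the entries. -/
theorem continuous_vol : Continuous vol := by
  let e : Module.Basis (Fin 4) ℝ R4 := (EuclideanSpace.basisFun (Fin 4) ℝ).toBasis
  have h2 : Continuous fun v : Fin 4 → R4 => vol e * (e.toMatrix v).det := by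
    refine continuous_const.mul (Continuous.matrix_det (continuous_matrix fun i j => ?_))
    exact (e.coord i).continuous_of_finiteDimensional.comp (continuous_apply j)
  convert h2 using 1
  funext v
  rw [vol.eq_smul_basis_det e]
  simp [Module.Basis.det_apply]

/-- The volume form as a continuous multilinear map. -/
def volC : ContinuousMultilinearMap ℝ (fun _ : Fin 4 => R4) ℝ :=
  ⟨vol.toMultilinearMap, continuous_vol vol⟩

theorem volC_apply (v : Fin 4 → R4) : volC vol v = vol v := rfl

/-- `coord` as a linear map. -/
def coordL (b : Fin 4 → R4) (k : Fin 4) : R4 →ₗ[ℝ] ℝ where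
  toFun := coord vol b k
  map_add' x y := by simp only [coord, AlternatingMap.map_update_add, add_div]
  map_smul' c x := by
    simp only [coord, AlternatingMap.map_update_smul, smul_eq_mul, RingHom.id_apply, mul_div_assoc]

theorem coordL_apply (b : Fin 4 → R4) (k : Fin 4) (v : R4) : coordL vol b k v = coord vol b k v :=
  rfl

theorem coordL_self {b : Fin 4 → R4} (hb : vol b ≠ 0) (k j : Fin 4) :
    coordL vol b k (b j) = if j = k then 1 else 0 := by
  rw [coordL_apply, coord]
  split_ifs with h
  · subst h
    rw [Function.update_eq_self, div_self hb]
  · rw [AlternatingMap.map_update_self _ _ (Ne.symm h), zero_div]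

theorem coordL_four (b : Fin 4 → R4) (hb : vol b ≠ 0) (v : R4) :
    v = coordL vol b 0 v • b 0 + coordL vol b 1 v • b 1 + coordL vol b 2 v • b 2
      + coordL vol b 3 v • b 3 := by
  have := sum_coord_smul vol b hb v
  rw [Fin.sum_univ_four] at this
  exact this.symm

theorem linearIndependent_of_vol_ne_zero {b : Fin 4 → R4} (hb : vol b ≠ 0) :
    LinearIndependent ℝ b := by
  by_contra h
  exact hb (vol.map_linearDependent b h)

theorem vol_add_two (a b x y d : R4) :
    vol ![a, b, x + y, d] = vol ![a, b, x, d] + vol ![a, b, y, d] := by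
  have h : ∀ z, ![a, b, z, d] = Function.update ![a, b, 0, d] 2 z := fun z => by
    ext i; fin_cases i <;> rfl
  rw [h, h x, h y, AlternatingMap.map_update_add]

theorem vol_smul_two (a b x d : R4) (c : ℝ) :
    vol ![a, b, c • x, d] = c * vol ![a, b, x, d] := by
  have h : ∀ z, ![a, b, z, d] = Function.update ![a, b, 0, d] 2 z := fun z => by
    ext i; fin_cases i <;> rfl
  rw [h, h x, AlternatingMap.map_update_smul, smul_eq_mul]

theorem vol_add_three (a b x y d : R4) :
    vol ![a, b, d, x + y] = vol ![a, b, d, x] + vol ![a, b, d, y] := by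
  have h : ∀ z, ![a, b, d, z] = Function.update ![a, b, d, 0] 3 z := fun z => by
    ext i; fin_cases i <;> rfl
  rw [h, h x, h y, AlternatingMap.map_update_add]

theorem vol_smul_three (a b x d : R4) (c : ℝ) :
    vol ![a, b, d, c • x] = c * vol ![a, b, d, x] := by
  have h : ∀ z, ![a, b, d, z] = Function.update ![a, b, d, 0] 3 z := fun z => by
    ext i; fin_cases i <;> rfl
  rw [h, h x, AlternatingMap.map_update_smul, smul_eq_mul]

end LinearAlgebra

/-! ### Algebra of the affine metric. -/

section Metric

variable {M : Type*} [TopologicalSpace M] [ChartedSpace (EuclideanSpace ℝ (Fin 2)) M]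
  (f : M → R4) (vol : R4 [⋀^Fin 4]→ₗ[ℝ] ℝ) (X : Fin 2 → VField M) (p : M)

theorem metric_comm (y z : TangentSpace (𝓡 2) p) : metric f vol X p y z = metric f vol X p z y := by
  unfold metric formG
  rw [add_comm]

/-- The normalizing factor depends only on the frame and the point, so linearity is that of `formG`.
-/
theorem metric_combination (a b : ℝ) (y y' z : TangentSpace (𝓡 2) p) :
    metric f vol X p (a • y + b • y') z = a * metric f vol X p y z + b * metric f vol X p y' z := by
  unfold metric formG
  simp only [map_add, map_smul, vol_add_two, vol_smul_two, vol_add_three, vol_smul_three]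
  ring

end Metric

/-! ### Derivatives of the frame in terms of the frame. -/

section Frame

variable {M : Type*} [TopologicalSpace M] [ChartedSpace (EuclideanSpace ℝ (Fin 2)) M]
  (f : M → R4) (vol : R4 [⋀^Fin 4]→ₗ[ℝ] ℝ) (X : Fin 2 → VField M) (ξ : Fin 2 → M → R4)

theorem deriv_push_eq {p : M} (h : vol (frame f X ξ p) ≠ 0) (i j : Fin 2) :
    dirD (push f (X j)) p (X i p) = Gam f vol X ξ i j 0 p • push f (X 0) p
      + Gam f vol X ξ i j 1 p • push f (X 1) p + hform f vol X ξ 0 (X i) (X j) p • ξ 0 p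
      + hform f vol X ξ 1 (X i) (X j) p • ξ 1 p :=
  coordL_four vol _ h _

theorem deriv_xi_eq {p : M} (h : vol (frame f X ξ p) ≠ 0) (i j : Fin 2) :
    dirD (ξ j) p (X i p) = -lam f vol X ξ j i 0 p • push f (X 0) p
      + -lam f vol X ξ j i 1 p • push f (X 1) p + tau f vol X ξ j 0 (X i) p • ξ 0 p
      + tau f vol X ξ j 1 (X i) p • ξ 1 p := by
  have := coordL_four vol _ h (dirD (ξ j) p (X i p))
  simp only [lam, neg_neg]
  exact this

/-- The coordinate of a vector along the `k`-th vector of the frame at `p`. -/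
def fcoord (p : M) (k : Fin 4) : R4 →ₗ[ℝ] ℝ := coordL vol (frame f X ξ p) k

theorem fcoord_push {p : M} (h : vol (frame f X ξ p) ≠ 0) (k : Fin 4) (j : Fin 2) :
    fcoord f vol X ξ p k (push f (X j) p) = if ![0, 1] j = k then 1 else 0 := by
  have := coordL_self vol h k (![0, 1] j)
  fin_cases j <;> exact this

theorem fcoord_tangent {p : M} (i j k : Fin 2) :
    fcoord f vol X ξ p (![0, 1] k) (dirD (push f (X j)) p (X i p)) = Gam f vol X ξ i j k p := rfl

theorem fcoord_normal {p : M} (m : Fin 2) (Y Z : VField M) :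
    fcoord f vol X ξ p (![2, 3] m) (dirD (push f Z) p (Y p)) = hform f vol X ξ m Y Z p := rfl

theorem fcoord_normal_xi {p : M} (j m : Fin 2) (Y : VField M) :
    fcoord f vol X ξ p (![2, 3] m) (dirD (ξ j) p (Y p)) = tau f vol X ξ j m Y p := rfl

theorem fcoord_tangent_xi (i j k : Fin 2) (p : M) :
    fcoord f vol X ξ p (![0, 1] k) (dirD (ξ j) p (X i p)) = -lam f vol X ξ j i k p :=
  (neg_neg _).symm

/-- The images of X₁, X₂ belong to a basis of ℝ⁴, so X₁, X₂ are independent in a two-dimensional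
tangent space. -/
theorem exists_tangent_combination {p : M} (h : vol (frame f X ξ p) ≠ 0)
    (v : TangentSpace (𝓡 2) p) : ∃ a b : ℝ, v = a • X 0 p + b • X 1 p := by
  have hli := linearIndependent_of_vol_ne_zero vol h
  have hli2 : LinearIndependent ℝ ![X 0 p, X 1 p] := by
    have h1 : LinearIndependent ℝ (frame f X ξ p ∘ ![0, 1]) :=
      hli.comp _ (by decide)
    have h2 : frame f X ξ p ∘ ![0, 1] = dirD f p ∘ ![X 0 p, X 1 p] := by
      funext i; fin_cases i <;> rfl
    rw [h2] at h1
    exact LinearIndependent.of_comp (dirD f p : TangentSpace (𝓡 2) p →ₗ[ℝ] R4) h1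
  have hcard : Fintype.card (Fin 2) = Module.finrank ℝ (TangentSpace (𝓡 2) p) := by
    change _ = Module.finrank ℝ (EuclideanSpace ℝ (Fin 2))
    simp
  have hspan := hli2.span_eq_top_of_card_eq_finrank hcard
  have hv : v ∈ Submodule.span ℝ (Set.range ![X 0 p, X 1 p]) := hspan ▸ Submodule.mem_top
  obtain ⟨c, hc⟩ := (Submodule.mem_span_range_iff_exists_fun ℝ).1 hv
  refine ⟨c 0, c 1, ?_⟩
  rw [← hc, Fin.sum_univ_two]
  rfl

end Frame

/-- The components `h^k(X_i, X_j)` in an adapted frame. -/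
def hval (ε : ℝ) (k i j : Fin 2) : ℝ := (![!![1, 0; 0, -ε], !![0, 1; 1, 0]] k) i j

/-! ### Smoothness and structure equations of an adapted frame. -/

section AdaptedFrame

variable {M : Type*} [TopologicalSpace M] [ChartedSpace (EuclideanSpace ℝ (Fin 2)) M]
  [IsManifold (𝓡 2) ∞ M] {f : M → R4} {vol : R4 [⋀^Fin 4]→ₗ[ℝ] ℝ} {ε : ℝ}
  {U : Set M} {X : Fin 2 → VField M} {ξ : Fin 2 → M → R4}

theorem IsAffineNormalFrame.vol_ne_zero (h : IsAffineNormalFrame ε f vol U X ξ) {p : M}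
    (hp : p ∈ U) : vol (frame f X ξ p) ≠ 0 := by
  rw [h.vol_eq p hp]
  exact one_ne_zero

theorem IsAffineNormalFrame.smooth_push (hf : IsImmersedSurface f)
    (h : IsAffineNormalFrame ε f vol U X ξ) (i : Fin 2) :
    ContMDiffOn (𝓡 2) 𝓘(ℝ, R4) ∞ (push f (X i)) U :=
  contMDiffOn_dirD h.isOpen hf.1.contMDiffOn (h.smooth_X i)

theorem IsAffineNormalFrame.smooth_frame (hf : IsImmersedSurface f)
    (h : IsAffineNormalFrame ε f vol U X ξ) :
    ContMDiffOn (𝓡 2) 𝓘(ℝ, Fin 4 → R4) ∞ (frame f X ξ) U := by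
  rw [contMDiffOn_pi_space]
  intro k
  fin_cases k
  · exact h.smooth_push hf 0
  · exact h.smooth_push hf 1
  · exact h.smooth_ξ 0
  · exact h.smooth_ξ 1

/-- Since the frame has volume 1 on `U`, the denominator in Cramer's rule disappears and the
coordinate is multilinear in smooth data. Smoothness of Γ, τ and λ all comes from here. -/
theorem IsAffineNormalFrame.smooth_fcoord (hf : IsImmersedSurface f)
    (h : IsAffineNormalFrame ε f vol U X ξ) (k : Fin 4) {v : M → R4}
    (hv : ContMDiffOn (𝓡 2) 𝓘(ℝ, R4) ∞ v U) :
    ContMDiffOn (𝓡 2) 𝓘(ℝ, ℝ) ∞ (fun q => fcoord f vol X ξ q k (v q)) U := by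
  have h1 : ContMDiffOn (𝓡 2) 𝓘(ℝ, Fin 4 → R4) ∞
      (fun q => Function.update (frame f X ξ q) k (v q)) U := by
    rw [contMDiffOn_pi_space]
    intro j
    by_cases hj : j = k
    · subst hj
      simpa using hv
    · simp only [Function.update_of_ne hj]
      exact contMDiffOn_pi_space.1 (h.smooth_frame hf) j
  have h2 := contMDiffOn_comp h1 (g := volC vol)
    fun q _ => (volC vol).contDiff.contDiffAt
  refine h2.congr fun q hq => ?_
  change vol _ / vol _ = vol _
  rw [h.vol_eq q hq, div_one]

theorem IsAffineNormalFrame.smooth_deriv_push (hf : IsImmersedSurface f)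
    (h : IsAffineNormalFrame ε f vol U X ξ) (i j : Fin 2) :
    ContMDiffOn (𝓡 2) 𝓘(ℝ, R4) ∞ (fun q => dirD (push f (X j)) q (X i q)) U :=
  contMDiffOn_dirD h.isOpen (h.smooth_push hf j) (h.smooth_X i)

theorem IsAffineNormalFrame.smooth_deriv_xi
    (h : IsAffineNormalFrame ε f vol U X ξ) (i j : Fin 2) :
    ContMDiffOn (𝓡 2) 𝓘(ℝ, R4) ∞ (fun q => dirD (ξ j) q (X i q)) U :=
  contMDiffOn_dirD h.isOpen (h.smooth_ξ j) (h.smooth_X i)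

theorem IsAffineNormalFrame.smooth_Gam (hf : IsImmersedSurface f)
    (h : IsAffineNormalFrame ε f vol U X ξ) (i j k : Fin 2) :
    ContMDiffOn (𝓡 2) 𝓘(ℝ, ℝ) ∞ (Gam f vol X ξ i j k) U :=
  h.smooth_fcoord hf _ (h.smooth_deriv_push hf i j)

theorem IsAffineNormalFrame.smooth_tau (hf : IsImmersedSurface f)
    (h : IsAffineNormalFrame ε f vol U X ξ) (i j k : Fin 2) :
    ContMDiffOn (𝓡 2) 𝓘(ℝ, ℝ) ∞ (tau f vol X ξ i j (X k)) U :=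
  h.smooth_fcoord hf _ (h.smooth_deriv_xi k i)

theorem IsAffineNormalFrame.smooth_lam (hf : IsImmersedSurface f)
    (h : IsAffineNormalFrame ε f vol U X ξ) (i j k : Fin 2) :
    ContMDiffOn (𝓡 2) 𝓘(ℝ, ℝ) ∞ (lam f vol X ξ i j k) U :=
  (h.smooth_fcoord hf _ (h.smooth_deriv_xi j i)).neg

/-- The connection is unimodular with respect to the frame. -/
theorem IsAffineNormalFrame.trace_eq_zero (hf : IsImmersedSurface f)
    (h : IsAffineNormalFrame ε f vol U X ξ) {p : M} (hp : p ∈ U) (i : Fin 2) :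
    Gam f vol X ξ i 0 0 p + Gam f vol X ξ i 1 1 p + tau f vol X ξ 0 0 (X i) p
      + tau f vol X ξ 1 1 (X i) p = 0 := by
  have hd := mdifferentiableAt_of_contMDiffOn h.isOpen (h.smooth_frame hf) hp
  have h0 := dirD_eq_zero_of_const_on h.isOpen (F := fun q => volC vol (frame f X ξ q))
    (fun q hq => h.vol_eq q hq) hp
  have h1 := dirD_comp hd ((volC vol).hasFDerivAt _).differentiableAt (X i p)
  rw [h0, ((volC vol).hasFDerivAt _).fderiv, ContinuousMultilinearMap.linearDeriv_apply] at h1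
  have hc : ∀ k, dirD (frame f X ξ) p (X i p) k = dirD (fun q => frame f X ξ q k) p (X i p) :=
    fun k => (dirD_comp_clm (ContinuousLinearMap.proj k) hd (X i p)).symm
  simp only [hc, Fin.sum_univ_four, volC_apply] at h1
  have hv := h.vol_eq p hp
  -- The derivative of the determinant is a sum over the four slots. At volume 1 each slot
  -- contributes the diagonal coordinate of the differentiated frame vector, so the sum is a trace.
  have key : ∀ k v, vol (Function.update (frame f X ξ p) k v) = coord vol (frame f X ξ p) k v := by
    intro k v
    rw [coord, hv, div_one]
  simp only [key] at h1
  exact h1.symm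

/-- The commutator of the frame fields; the forms `h` are symmetric. -/
theorem IsAffineNormalFrame.commutator (hf : IsImmersedSurface f)
    (h : IsAffineNormalFrame ε f vol U X ξ) {p : M} (hp : p ∈ U) :
    (∀ m, hform f vol X ξ m (X 0) (X 1) p = hform f vol X ξ m (X 1) (X 0) p) ∧
    ∀ F : M → R4, ContMDiffOn (𝓡 2) 𝓘(ℝ, R4) ∞ F U →
      dirD (fun q => dirD F q (X 1 q)) p (X 0 p) - dirD (fun q => dirD F q (X 0 q)) p (X 1 p)
        = (Gam f vol X ξ 0 1 0 p - Gam f vol X ξ 1 0 0 p) • dirD F p (X 0 p)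
          + (Gam f vol X ξ 0 1 1 p - Gam f vol X ξ 1 0 1 p) • dirD F p (X 1 p) := by
  have hv := h.vol_ne_zero hp
  obtain ⟨Z, hZ⟩ := exists_commutator (E := R4) h.isOpen (h.smooth_X 0) (h.smooth_X 1) hp
  obtain ⟨a, b, rfl⟩ := exists_tangent_combination f vol X ξ hv Z
  have hfZ : dirD (push f (X 1)) p (X 0 p) - dirD (push f (X 0)) p (X 1 p)
      = a • push f (X 0) p + b • push f (X 1) p := by
    -- The bracket is identified by applying the commutator to the immersion itself: tangential
    -- coordinates give its components as differences of Γ, normal ones give the symmetry of h.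
    have := hZ f hf.1.contMDiffOn
    rw [map_add, map_smul, map_smul] at this
    exact this
  have hk : ∀ k, fcoord f vol X ξ p k (dirD (push f (X 1)) p (X 0 p))
      - fcoord f vol X ξ p k (dirD (push f (X 0)) p (X 1 p))
      = a * (if 0 = k then 1 else 0) + b * (if 1 = k then 1 else 0) := by
    intro k
    have := congrArg (fcoord f vol X ξ p k) hfZ
    rw [map_sub, map_add, map_smul, map_smul, fcoord_push f vol X ξ hv,
      fcoord_push f vol X ξ hv] at this
    exact this
  have e0 : Gam f vol X ξ 0 1 0 p - Gam f vol X ξ 1 0 0 p = a := by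
    have := hk (![0, 1] 0)
    rw [fcoord_tangent, fcoord_tangent] at this
    simpa using this
  have e1 : Gam f vol X ξ 0 1 1 p - Gam f vol X ξ 1 0 1 p = b := by
    have := hk (![0, 1] 1)
    rw [fcoord_tangent, fcoord_tangent] at this
    simpa using this
  refine ⟨fun m => ?_, fun F hF => ?_⟩
  · have := hk (![2, 3] m)
    rw [fcoord_normal, fcoord_normal] at this
    rw [← sub_eq_zero, this]
    fin_cases m <;> simp
  · rw [hZ F hF, e0, e1, map_add, map_smul, map_smul]

/-- The normalization prescribes three of the four entries of each form; the remaining one follows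
from symmetry. -/
theorem IsAffineNormalFrame.hform_eq (hf : IsImmersedSurface f)
    (h : IsAffineNormalFrame ε f vol U X ξ) {p : M} (hp : p ∈ U) (k i j : Fin 2) :
    hform f vol X ξ k (X i) (X j) p = hval ε k i j := by
  have hs := (h.commutator hf hp).1
  fin_cases k <;> fin_cases i <;> fin_cases j
  · exact h.h1_11 p hp
  · exact h.h1_12 p hp
  · exact (hs 0).symm.trans (h.h1_12 p hp)
  · exact h.h1_22 p hp
  · exact h.h2_11 p hp
  · exact h.h2_12 p hp
  · exact (hs 1).symm.trans (h.h2_12 p hp)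
  · exact h.h2_22 p hp

theorem IsAffineNormalFrame.mdiff_push (hf : IsImmersedSurface f)
    (h : IsAffineNormalFrame ε f vol U X ξ) {p : M} (hp : p ∈ U) (i : Fin 2) :
    MDifferentiableAt (𝓡 2) 𝓘(ℝ, R4) (push f (X i)) p :=
  mdifferentiableAt_of_contMDiffOn h.isOpen (h.smooth_push hf i) hp

theorem IsAffineNormalFrame.mdiff_Gam (hf : IsImmersedSurface f)
    (h : IsAffineNormalFrame ε f vol U X ξ) {p : M} (hp : p ∈ U) (i j k : Fin 2) :
    MDifferentiableAt (𝓡 2) 𝓘(ℝ, ℝ) (Gam f vol X ξ i j k) p :=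
  mdifferentiableAt_of_contMDiffOn h.isOpen (h.smooth_Gam hf i j k) hp

/-- The normal part of the derivative of a tangent field. -/
theorem IsAffineNormalFrame.fcoord_dirD_tangent (hf : IsImmersedSurface f)
    (h : IsAffineNormalFrame ε f vol U X ξ) {p : M} (hp : p ∈ U) {a b : M → ℝ}
    (ha : MDifferentiableAt (𝓡 2) 𝓘(ℝ, ℝ) a p) (hb : MDifferentiableAt (𝓡 2) 𝓘(ℝ, ℝ) b p)
    (i m : Fin 2) :
    MDifferentiableAt (𝓡 2) 𝓘(ℝ, R4) (fun q => a q • push f (X 0) q + b q • push f (X 1) q) p ∧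
    fcoord f vol X ξ p (![2, 3] m)
      (dirD (fun q => a q • push f (X 0) q + b q • push f (X 1) q) p (X i p))
      = a p * hval ε m i 0 + b p * hval ε m i 1 := by
  have hv := h.vol_ne_zero hp
  have h0 := h.mdiff_push hf hp 0
  have h1 := h.mdiff_push hf hp 1
  have ha0 := mdifferentiableAt_smul ha h0
  have hb1 := mdifferentiableAt_smul hb h1
  refine ⟨mdifferentiableAt_add ha0 hb1, ?_⟩
  rw [dirD_add ha0 hb1, dirD_smul ha h0, dirD_smul hb h1]
  simp only [map_add, map_smul, fcoord_normal, h.hform_eq hf hp, fcoord_push f vol X ξ hv]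
  fin_cases m <;> simp

/-- In D_{X_k} X_j the tangential coefficients contribute to the normal part only through h, and the
normal coefficients are constant, so they contribute only through τ. -/
theorem IsAffineNormalFrame.fcoord_second_deriv (hf : IsImmersedSurface f)
    (h : IsAffineNormalFrame ε f vol U X ξ) {p : M} (hp : p ∈ U) (i k j m : Fin 2) :
    fcoord f vol X ξ p (![2, 3] m)
      (dirD (fun q => dirD (push f (X j)) q (X k q)) p (X i p))
      = Gam f vol X ξ k j 0 p * hval ε m i 0 + Gam f vol X ξ k j 1 p * hval ε m i 1
        + hval ε 0 k j * tau f vol X ξ 0 m (X i) p + hval ε 1 k j * tau f vol X ξ 1 m (X i) p := by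
  have hfun : ∀ q ∈ U, dirD (push f (X j)) q (X k q)
      = (Gam f vol X ξ k j 0 q • push f (X 0) q + Gam f vol X ξ k j 1 q • push f (X 1) q)
        + (hval ε 0 k j • ξ 0 q + hval ε 1 k j • ξ 1 q) := by
    intro q hq
    rw [deriv_push_eq f vol X ξ (h.vol_ne_zero hq) k j, h.hform_eq hf hq, h.hform_eq hf hq]
    abel
  rw [dirD_congr_on h.isOpen hfun hp]
  obtain ⟨h1, h2⟩ := h.fcoord_dirD_tangent hf hp (h.mdiff_Gam hf hp k j 0)
    (h.mdiff_Gam hf hp k j 1) i m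
  have hx : ∀ c, MDifferentiableAt (𝓡 2) 𝓘(ℝ, R4) (ξ c) p := fun c =>
    mdifferentiableAt_of_contMDiffOn h.isOpen (h.smooth_ξ c) hp
  have hc : ∀ c : ℝ, MDifferentiableAt (𝓡 2) 𝓘(ℝ, ℝ) (fun _ : M => c) p := fun c =>
    mdifferentiableAt_const
  have hz : ∀ c : ℝ, dirD (fun _ : M => c) p = 0 := fun c =>
    dirD_eq_zero_of_const_on isOpen_univ (fun _ _ => rfl) (Set.mem_univ p)
  have hs := fun c => mdifferentiableAt_smul (hc (hval ε c k j)) (hx c)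
  rw [dirD_add h1 (mdifferentiableAt_add (hs 0) (hs 1)), map_add, h2, dirD_add (hs 0) (hs 1), dirD_smul (hc _) (hx 0),
    dirD_smul (hc _) (hx 1), hz, hz]
  simp only [map_add, map_smul, fcoord_normal_xi, zero_apply, zero_smul,
    zero_add, smul_eq_mul]
  ring

/-- The Codazzi equations for `h`. -/
theorem IsAffineNormalFrame.codazzi (hf : IsImmersedSurface f)
    (h : IsAffineNormalFrame ε f vol U X ξ) {p : M} (hp : p ∈ U) (j m : Fin 2) :
    (Gam f vol X ξ 1 j 0 p * hval ε m 0 0 + Gam f vol X ξ 1 j 1 p * hval ε m 0 1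
        + hval ε 0 1 j * tau f vol X ξ 0 m (X 0) p + hval ε 1 1 j * tau f vol X ξ 1 m (X 0) p)
      - (Gam f vol X ξ 0 j 0 p * hval ε m 1 0 + Gam f vol X ξ 0 j 1 p * hval ε m 1 1
        + hval ε 0 0 j * tau f vol X ξ 0 m (X 1) p + hval ε 1 0 j * tau f vol X ξ 1 m (X 1) p)
      = (Gam f vol X ξ 0 1 0 p - Gam f vol X ξ 1 0 0 p) * hval ε m 0 j
          + (Gam f vol X ξ 0 1 1 p - Gam f vol X ξ 1 0 1 p) * hval ε m 1 j := by
  -- Flatness of D is the commutator formula applied to the ℝ⁴-valued field X_j; its normal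
  -- coordinates are the Codazzi equations.
  have := congrArg (fcoord f vol X ξ p (![2, 3] m))
    ((h.commutator hf hp).2 _ (h.smooth_push hf j))
  rw [map_sub, map_add, map_smul, map_smul, h.fcoord_second_deriv hf hp,
    h.fcoord_second_deriv hf hp, fcoord_normal, fcoord_normal, h.hform_eq hf hp,
    h.hform_eq hf hp] at this
  exact this

/-- The components of h are constant in the frame, so the derivative term vanishes and the cubic
form becomes algebraic in Γ and τ. -/
theorem IsAffineNormalFrame.cubic_eq (hf : IsImmersedSurface f)
    (h : IsAffineNormalFrame ε f vol U X ξ) {p : M} (hp : p ∈ U) (m i a b : Fin 2) :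
    cubic f vol X ξ m (X i) (X a) (X b) p =
      -(Gam f vol X ξ i a 0 p * hval ε m 0 b + Gam f vol X ξ i a 1 p * hval ε m 1 b)
      - (Gam f vol X ξ i b 0 p * hval ε m a 0 + Gam f vol X ξ i b 1 p * hval ε m a 1)
      + tau f vol X ξ 0 m (X i) p * hval ε 0 a b + tau f vol X ξ 1 m (X i) p * hval ε 1 a b := by
  have h1 : dirD (hform f vol X ξ m (X a) (X b)) p = 0 :=
    dirD_eq_zero_of_const_on h.isOpen (fun q hq => h.hform_eq hf hq m a b) hp
  have h2 : hform f vol X ξ m (nabla f vol X ξ (X i) (X a)) (X b) p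
      = Gam f vol X ξ i a 0 p * hval ε m 0 b + Gam f vol X ξ i a 1 p * hval ε m 1 b := by
    change fcoord f vol X ξ p (![2, 3] m) (dirD (push f (X b)) p
      (Gam f vol X ξ i a 0 p • X 0 p + Gam f vol X ξ i a 1 p • X 1 p)) = _
    rw [map_add, map_smul, map_smul, map_add, map_smul, map_smul, fcoord_normal, fcoord_normal,
      h.hform_eq hf hp, h.hform_eq hf hp]
    rfl
  have h3 : hform f vol X ξ m (X a) (nabla f vol X ξ (X i) (X b)) p
      = Gam f vol X ξ i b 0 p * hval ε m a 0 + Gam f vol X ξ i b 1 p * hval ε m a 1 := by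
    have hp2 : push f (nabla f vol X ξ (X i) (X b)) = fun q =>
        Gam f vol X ξ i b 0 q • push f (X 0) q + Gam f vol X ξ i b 1 q • push f (X 1) q := by
      funext q
      change dirD f q (Gam f vol X ξ i b 0 q • X 0 q + Gam f vol X ξ i b 1 q • X 1 q) = _
      rw [map_add, map_smul, map_smul]
      rfl
    rw [← fcoord_normal, hp2]
    exact (h.fcoord_dirD_tangent hf hp (h.mdiff_Gam hf hp i b 0) (h.mdiff_Gam hf hp i b 1) a m).2
  rw [cubic, h1, h2, h3, h.hform_eq hf hp, h.hform_eq hf hp, zero_apply]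
  ring

theorem IsAffineNormalFrame.metric_eq (h : IsAffineNormalFrame ε f vol U X ξ) {p : M} (hp : p ∈ U)
    (i j : Fin 2) : metric f vol X p (X i p) (X j p) = !![ε, 0; 0, 1] i j := by
  fin_cases i <;> fin_cases j
  · exact h.metric₁₁ p hp
  · exact h.metric₁₂ p hp
  · exact (metric_comm f vol X p _ _).trans (h.metric₁₂ p hp)
  · exact h.metric₂₂ p hp

/-- Orthonormality makes the metric components constant, so the normal plane conditions become
linear in Γ. -/
theorem IsAffineNormalFrame.nablaMetric_eq (h : IsAffineNormalFrame ε f vol U X ξ) {p : M}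
    (hp : p ∈ U) (i a b : Fin 2) :
    nablaMetric f vol X ξ (X i) (X a) (X b) p =
      -(Gam f vol X ξ i a 0 p * !![ε, 0; 0, 1] 0 b + Gam f vol X ξ i a 1 p * !![ε, 0; 0, 1] 1 b)
      - (Gam f vol X ξ i b 0 p * !![ε, 0; 0, 1] 0 a
        + Gam f vol X ξ i b 1 p * !![ε, 0; 0, 1] 1 a) := by
  have h1 : dirD (fun q => metric f vol X q (X a q) (X b q)) p = 0 :=
    dirD_eq_zero_of_const_on h.isOpen (fun q hq => h.metric_eq hq a b) hp
  have h2 : ∀ b' a', metric f vol X p (nabla f vol X ξ (X i) (X a') p) (X b' p) =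
      Gam f vol X ξ i a' 0 p * !![ε, 0; 0, 1] 0 b'
        + Gam f vol X ξ i a' 1 p * !![ε, 0; 0, 1] 1 b' := by
    intro b' a'
    rw [← h.metric_eq hp, ← h.metric_eq hp]
    exact metric_combination f vol X p _ _ _ _ _
  rw [nablaMetric, h1, h2, metric_comm, h2, zero_apply]
  ring

end AdaptedFrame

/-! ### The square of a symplectic form as a volume form. -/

section SymplecticLinearAlgebra

/-- `Ω ∧ Ω` as an alternating form. -/
def wedgeSqForm (Ω : LinearMap.BilinForm ℝ R4) (hΩ : Ω.IsAlt) : R4 [⋀^Fin 4]→ₗ[ℝ] ℝ :=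
  { toFun := wedgeSq Ω
    map_update_add' := by
      intro inst m i x y
      obtain rfl : inst = instDecidableEqFin 4 := Subsingleton.elim _ _
      match i with
      | 0 => simp [wedgeSq]; ring
      | 1 => simp [wedgeSq]; ring
      | 2 => simp [wedgeSq]; ring
      | 3 => simp [wedgeSq]; ring
    map_update_smul' := by
      intro inst m i c x
      obtain rfl : inst = instDecidableEqFin 4 := Subsingleton.elim _ _
      match i with
      | 0 => simp [wedgeSq]; ring
      | 1 => simp [wedgeSq]; ring
      | 2 => simp [wedgeSq]; ring
      | 3 => simp [wedgeSq]; ring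
    map_eq_zero_of_eq' := by
      intro v i j hij hne
      have hself : ∀ x, Ω x x = 0 := hΩ
      have hneg : ∀ x y, Ω x y = -Ω y x := fun x y => (LinearMap.IsAlt.neg hΩ y x).symm
      fin_cases i <;> fin_cases j <;>
        first
          | exact absurd rfl hne
          | (simp only [Fin.mk_zero, Fin.mk_one, Fin.reduceFinMk] at hij
             simp only [wedgeSq, hij, hself, hneg (v 1) (v 0), hneg (v 2) (v 0),
               hneg (v 2) (v 1), hneg (v 3) (v 1), hneg (v 3) (v 2)]
             ring) }

theorem wedgeSqForm_apply (Ω : LinearMap.BilinForm ℝ R4) (hΩ : Ω.IsAlt) (v : Fin 4 → R4) :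
    wedgeSqForm Ω hΩ v = wedgeSq Ω v := rfl

/-- Choose a, b with Ω(a, b) ≠ 0 and a nonzero x orthogonal to both, which exists since two
equations cannot cut ℝ⁴ down to zero. Then (Ω ∧ Ω)(a, b, x, y) = 2 Ω(a, b) Ω(x, y), so vanishing
would put x in the radical. -/
theorem wedgeSqForm_ne_zero {Ω : LinearMap.BilinForm ℝ R4} (hΩ : IsSymplectic Ω) :
    wedgeSqForm Ω hΩ.1 ≠ 0 := by
  intro h0
  have hw : ∀ v, wedgeSq Ω v = 0 := fun v => by
    rw [← wedgeSqForm_apply Ω hΩ.1, h0]; rfl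
  obtain ⟨a, ha⟩ := exists_ne (0 : R4)
  obtain ⟨b, hb⟩ : ∃ b, Ω a b ≠ 0 := by
    by_contra! hcon
    exact ha (hΩ.2.1 a hcon)
  have hker : LinearMap.ker ((Ω a).prod (Ω b)) ≠ ⊥ :=
    LinearMap.ker_ne_bot_of_finrank_lt (by simp)
  obtain ⟨x, hx, hx0⟩ := Submodule.exists_mem_ne_zero_of_ne_bot hker
  have hx1 : Ω a x = 0 ∧ Ω b x = 0 := by
    simpa [LinearMap.mem_ker] using hx
  refine hx0 (hΩ.2.1 x fun y => ?_)
  have := hw ![a, b, x, y]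
  simp [wedgeSq, hx1.1, hx1.2] at this
  tauto

/-- The 4-forms on ℝ⁴ form a line, and both forms are nonzero. -/
theorem exists_wedgeSq_eq {vol : R4 [⋀^Fin 4]→ₗ[ℝ] ℝ} (hvol : vol ≠ 0)
    {Ω : LinearMap.BilinForm ℝ R4} (hΩ : IsSymplectic Ω) :
    ∃ c : ℝ, c ≠ 0 ∧ ∀ v, wedgeSq Ω v = c * vol v := by
  let e : Module.Basis (Fin 4) ℝ R4 := (EuclideanSpace.basisFun (Fin 4) ℝ).toBasis
  have h1 := vol.eq_smul_basis_det e
  have h2 := (wedgeSqForm Ω hΩ.1).eq_smul_basis_det e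
  have hv : vol e ≠ 0 := fun h => hvol (by rw [h1, h, zero_smul])
  have hw : wedgeSqForm Ω hΩ.1 e ≠ 0 := fun h => wedgeSqForm_ne_zero hΩ (by rw [h2, h, zero_smul])
  refine ⟨wedgeSqForm Ω hΩ.1 e / vol e, div_ne_zero hw hv, fun v => ?_⟩
  rw [← wedgeSqForm_apply Ω hΩ.1]
  have h1v := congrArg (fun g : R4 [⋀^Fin 4]→ₗ[ℝ] ℝ => g v) h1
  have h2v := congrArg (fun g : R4 [⋀^Fin 4]→ₗ[ℝ] ℝ => g v) h2
  simp only [AlternatingMap.smul_apply, smul_eq_mul] at h1v h2v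
  rw [h2v, h1v]
  field_simp

/-- A bilinear form on `ℝ⁴` as a continuous bilinear map. -/
def bilinC (Ω : LinearMap.BilinForm ℝ R4) : R4 →L[ℝ] R4 →L[ℝ] ℝ :=
  LinearMap.toContinuousLinearMap
    ((LinearMap.toContinuousLinearMap : (R4 →ₗ[ℝ] ℝ) ≃ₗ[ℝ] (R4 →L[ℝ] ℝ)).toLinearMap ∘ₗ Ω)

end SymplecticLinearAlgebra

/-! ### Differentiating a constant bilinear form along the surface. -/

section Bilin

variable {M : Type*} [TopologicalSpace M] [ChartedSpace (EuclideanSpace ℝ (Fin 2)) M]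

theorem dirD_bilin (Ω : LinearMap.BilinForm ℝ R4) {u w : M → R4} {p : M}
    (hu : MDifferentiableAt (𝓡 2) 𝓘(ℝ, R4) u p) (hw : MDifferentiableAt (𝓡 2) 𝓘(ℝ, R4) w p)
    (v : TangentSpace (𝓡 2) p) :
    dirD (fun q => Ω (u q) (w q)) p v = Ω (dirD u p v) (w p) + Ω (u p) (dirD w p v) :=
  dirD_comp₂ (bilinC Ω) hu hw v

theorem contMDiffOn_bilin (Ω : LinearMap.BilinForm ℝ R4) {u w : M → R4} {U : Set M}
    (hu : ContMDiffOn (𝓡 2) 𝓘(ℝ, R4) ∞ u U) (hw : ContMDiffOn (𝓡 2) 𝓘(ℝ, R4) ∞ w U) :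
    ContMDiffOn (𝓡 2) 𝓘(ℝ, ℝ) ∞ (fun q => Ω (u q) (w q)) U :=
  contMDiffOn_comp (g := fun x : R4 × R4 => bilinC Ω x.1 x.2) (hu.prodMk_space hw)
    fun _ _ => (bilinC Ω).isBoundedBilinearMap.contDiff.contDiffAt

theorem IsLagrangianOn.push_push {Ω : LinearMap.BilinForm ℝ R4} {f : M → R4} {U : Set M}
    {X : Fin 2 → VField M} (hL : IsLagrangianOn Ω f U) {p : M}
    (hp : p ∈ U) (i j : Fin 2) : Ω (push f (X i) p) (push f (X j) p) = 0 :=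
  (hL p hp).2 _ ⟨X i p, rfl⟩ _ ⟨X j p, rfl⟩

end Bilin

/-! ### Reduction to six free connection coefficients. -/

section AdaptedFrame

variable {M : Type*} [TopologicalSpace M] [ChartedSpace (EuclideanSpace ℝ (Fin 2)) M]
  [IsManifold (𝓡 2) ∞ M] {f : M → R4} {vol : R4 [⋀^Fin 4]→ₗ[ℝ] ℝ} {ε : ℝ}
  {U : Set M} {X : Fin 2 → VField M} {ξ : Fin 2 → M → R4}

/-- The Codazzi equations and the conditions on the affine normal plane bundle, solved for ten of
the sixteen coefficients. -/
theorem IsAffineNormalFrame.relations (hf : IsImmersedSurface f) (hε : ε = 1 ∨ ε = -1)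
    (h : IsAffineNormalFrame ε f vol U X ξ) {p : M} (hp : p ∈ U) :
    tau f vol X ξ 1 1 (X 1) p = -tau f vol X ξ 0 0 (X 1) p ∧
    tau f vol X ξ 1 1 (X 0) p = -tau f vol X ξ 0 0 (X 0) p ∧
    tau f vol X ξ 1 0 (X 1) p = -2 * ε * Gam f vol X ξ 1 0 1 p - ε * tau f vol X ξ 0 0 (X 0) p ∧
    tau f vol X ξ 1 0 (X 0) p = 2 * Gam f vol X ξ 0 1 0 p + tau f vol X ξ 0 0 (X 1) p ∧
    tau f vol X ξ 0 1 (X 1) p = 2 * Gam f vol X ξ 1 0 1 p - tau f vol X ξ 0 0 (X 0) p ∧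
    tau f vol X ξ 0 1 (X 0) p = -2 * ε * Gam f vol X ξ 0 1 0 p + ε * tau f vol X ξ 0 0 (X 1) p ∧
    Gam f vol X ξ 1 1 1 p = (ε * Gam f vol X ξ 0 0 1 p + Gam f vol X ξ 0 1 0 p) / 2 ∧
    Gam f vol X ξ 1 1 0 p = 2 * ε * Gam f vol X ξ 0 0 0 p - ε * Gam f vol X ξ 1 0 1 p ∧
    Gam f vol X ξ 1 0 0 p = -(ε * Gam f vol X ξ 0 0 1 p + Gam f vol X ξ 0 1 0 p) / 2 ∧
    Gam f vol X ξ 0 1 1 p = -Gam f vol X ξ 0 0 0 p := by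
  -- Ten linear equations: two traces, four Codazzi, four for the normal plane. The coefficients
  -- left free are Γ₁₁¹, Γ₁₁², Γ₁₂¹, Γ₂₁², τ₁¹(X₁), τ₁¹(X₂).
  have t0 := h.trace_eq_zero hf hp 0
  have t1 := h.trace_eq_zero hf hp 1
  have c00 := h.codazzi hf hp 0 0
  have c01 := h.codazzi hf hp 0 1
  have c10 := h.codazzi hf hp 1 0
  have c11 := h.codazzi hf hp 1 1
  have e1 := h.equiaffine₁ p hp
  have e2 := h.equiaffine₂ p hp
  have n1 := h.normal₁ p hp
  have n2 := h.normal₂ p hp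
  simp only [h.nablaMetric_eq hp] at e1 e2 n1 n2
  simp [hval] at c00 c01 c10 c11 e1 e2 n1 n2
  rcases hε with rfl | rfl <;> refine ⟨?_, ?_, ?_, ?_, ?_, ?_, ?_, ?_, ?_, ?_⟩ <;> linarith

end AdaptedFrame

/-! ### Consequences of the Lagrangian condition: the kernel of H and the Wronskian. -/

section LagrangianSurface

variable {M : Type*} [TopologicalSpace M] [ChartedSpace (EuclideanSpace ℝ (Fin 2)) M]
  [IsManifold (𝓡 2) ∞ M] {f : M → R4} {vol : R4 [⋀^Fin 4]→ₗ[ℝ] ℝ} {ε : ℝ}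
  {U : Set M} {X : Fin 2 → VField M} {ξ : Fin 2 → M → R4}

/-- Product rule; the shape operator terms of Dξ_b drop out because Ω vanishes on tangent vectors.
-/
theorem IsAffineNormalFrame.dirD_pairing (hf : IsImmersedSurface f)
    (h : IsAffineNormalFrame ε f vol U X ξ) {Ω : LinearMap.BilinForm ℝ R4}
    (hL : IsLagrangianOn Ω f U) {p : M} (hp : p ∈ U) (i a b : Fin 2) :
    dirD (fun q => Ω (push f (X a) q) (ξ b q)) p (X i p) =
      Gam f vol X ξ i a 0 p * Ω (push f (X 0) p) (ξ b p)
      + Gam f vol X ξ i a 1 p * Ω (push f (X 1) p) (ξ b p)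
      + hval ε 0 i a * Ω (ξ 0 p) (ξ b p) + hval ε 1 i a * Ω (ξ 1 p) (ξ b p)
      + tau f vol X ξ b 0 (X i) p * Ω (push f (X a) p) (ξ 0 p)
      + tau f vol X ξ b 1 (X i) p * Ω (push f (X a) p) (ξ 1 p) := by
  have hv := h.vol_ne_zero hp
  rw [dirD_bilin Ω (h.mdiff_push hf hp a)
    (mdifferentiableAt_of_contMDiffOn h.isOpen (h.smooth_ξ b) hp),
    deriv_push_eq f vol X ξ hv, deriv_xi_eq f vol X ξ hv, h.hform_eq hf hp, h.hform_eq hf hp]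
  simp only [map_add, map_smul, LinearMap.add_apply, LinearMap.smul_apply, smul_eq_mul,
    hL.push_push hp]
  ring

/-- Here the shape operators do enter; this is the source of the rows of L. -/
theorem IsAffineNormalFrame.dirD_xi_xi
    (h : IsAffineNormalFrame ε f vol U X ξ) {Ω : LinearMap.BilinForm ℝ R4} (hΩ : Ω.IsAlt)
    {p : M} (hp : p ∈ U) (i : Fin 2) :
    dirD (fun q => Ω (ξ 0 q) (ξ 1 q)) p (X i p) =
      -lam f vol X ξ 0 i 0 p * Ω (push f (X 0) p) (ξ 1 p)
      - lam f vol X ξ 0 i 1 p * Ω (push f (X 1) p) (ξ 1 p)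
      + lam f vol X ξ 1 i 0 p * Ω (push f (X 0) p) (ξ 0 p)
      + lam f vol X ξ 1 i 1 p * Ω (push f (X 1) p) (ξ 0 p)
      + (tau f vol X ξ 0 0 (X i) p + tau f vol X ξ 1 1 (X i) p) * Ω (ξ 0 p) (ξ 1 p) := by
  have hv := h.vol_ne_zero hp
  have hx : ∀ c, MDifferentiableAt (𝓡 2) 𝓘(ℝ, R4) (ξ c) p := fun c =>
    mdifferentiableAt_of_contMDiffOn h.isOpen (h.smooth_ξ c) hp
  have hself : ∀ x, Ω x x = 0 := hΩ
  rw [dirD_bilin Ω (hx 0) (hx 1), deriv_xi_eq f vol X ξ hv, deriv_xi_eq f vol X ξ hv]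
  simp only [map_add, map_smul, LinearMap.add_apply, LinearMap.smul_apply, smul_eq_mul, hself,
    ← LinearMap.IsAlt.neg hΩ (push f (X 0) p) (ξ 0 p),
    ← LinearMap.IsAlt.neg hΩ (push f (X 1) p) (ξ 0 p)]
  ring

/-- The pairings of the frame of a Lagrangian surface that come from differentiating
`Ω(X₁, X₂) = 0`. -/
theorem IsAffineNormalFrame.pairing_eq (hf : IsImmersedSurface f)
    (h : IsAffineNormalFrame ε f vol U X ξ) {Ω : LinearMap.BilinForm ℝ R4} (hΩ : Ω.IsAlt)
    (hL : IsLagrangianOn Ω f U) {p : M} (hp : p ∈ U) :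
    Ω (push f (X 1) p) (ξ 0 p) = Ω (push f (X 0) p) (ξ 1 p) ∧
    Ω (push f (X 1) p) (ξ 1 p) = -ε * Ω (push f (X 0) p) (ξ 0 p) := by
  have hv := h.vol_ne_zero hp
  have h0 : dirD (fun q => Ω (push f (X 0) q) (push f (X 1) q)) p = 0 :=
    dirD_eq_zero_of_const_on h.isOpen (fun q hq => hL.push_push hq 0 1) hp
  have key : ∀ i, 0 = - hval ε 0 i 0 * Ω (push f (X 1) p) (ξ 0 p)
      - hval ε 1 i 0 * Ω (push f (X 1) p) (ξ 1 p) + hval ε 0 i 1 * Ω (push f (X 0) p) (ξ 0 p)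
      + hval ε 1 i 1 * Ω (push f (X 0) p) (ξ 1 p) := by
    intro i
    have h1 := dirD_bilin Ω (h.mdiff_push hf hp 0) (h.mdiff_push hf hp 1) (X i p)
    rw [h0, deriv_push_eq f vol X ξ hv, deriv_push_eq f vol X ξ hv, h.hform_eq hf hp,
      h.hform_eq hf hp, h.hform_eq hf hp, h.hform_eq hf hp] at h1
    simp only [map_add, map_smul, LinearMap.add_apply, LinearMap.smul_apply, smul_eq_mul,
      hL.push_push hp, ← LinearMap.IsAlt.neg hΩ (push f (X 1) p) (ξ 0 p),
      ← LinearMap.IsAlt.neg hΩ (push f (X 1) p) (ξ 1 p), zero_apply] at h1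
    linarith
  have k0 := key 0
  have k1 := key 1
  simp [hval] at k0 k1
  constructor <;> linarith

/-- The two linear equations on `Ω(X₁, ξ₂)`, `Ω(X₁, ξ₁)` which hold together with
`Ω(ξ₁, ξ₂) = 0`. -/
theorem IsAffineNormalFrame.algebraic_equations (hf : IsImmersedSurface f) (hε : ε = 1 ∨ ε = -1)
    (h : IsAffineNormalFrame ε f vol U X ξ) {Ω : LinearMap.BilinForm ℝ R4} (hΩ : Ω.IsAlt)
    (hL : IsLagrangianOn Ω f U) {p : M} (hp : p ∈ U) :
    Ω (ξ 0 p) (ξ 1 p) = 0 ∧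
    2 * (Gam f vol X ξ 0 0 0 p - tau f vol X ξ 0 0 (X 0) p) * Ω (push f (X 0) p) (ξ 1 p)
      + (2 * tau f vol X ξ 0 0 (X 1) p - ε * Gam f vol X ξ 0 0 1 p - Gam f vol X ξ 0 1 0 p)
        * Ω (push f (X 0) p) (ξ 0 p) = 0 ∧
    (2 * tau f vol X ξ 0 0 (X 1) p + ε * Gam f vol X ξ 0 0 1 p + Gam f vol X ξ 0 1 0 p)
        * Ω (push f (X 0) p) (ξ 1 p)
      + 2 * ε * (Gam f vol X ξ 0 0 0 p + tau f vol X ξ 0 0 (X 0) p)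
        * Ω (push f (X 0) p) (ξ 0 p) = 0 := by
  have hx : ∀ c, MDifferentiableAt (𝓡 2) 𝓘(ℝ, R4) (ξ c) p := fun c =>
    mdifferentiableAt_of_contMDiffOn h.isOpen (h.smooth_ξ c) hp
  have hself : ∀ x, Ω x x = 0 := hΩ
  obtain ⟨pe1, pe2⟩ := h.pairing_eq hf hΩ hL hp
  have d1 : ∀ i, dirD (fun q => Ω (push f (X 1) q) (ξ 0 q)) p (X i p)
      = dirD (fun q => Ω (push f (X 0) q) (ξ 1 q)) p (X i p) := fun i => by
    rw [dirD_congr_on h.isOpen (fun q hq => (h.pairing_eq hf hΩ hL hq).1) hp]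
  have hd00 : MDifferentiableAt (𝓡 2) 𝓘(ℝ, ℝ) (fun q => Ω (push f (X 0) q) (ξ 0 q)) p :=
    mdifferentiableAt_of_contMDiffOn h.isOpen
      (contMDiffOn_bilin Ω (h.smooth_push hf 0) (h.smooth_ξ 0)) hp
  have d2 : ∀ i, dirD (fun q => Ω (push f (X 1) q) (ξ 1 q)) p (X i p)
      = -ε * dirD (fun q => Ω (push f (X 0) q) (ξ 0 q)) p (X i p) := fun i => by
    rw [dirD_congr_on h.isOpen (fun q hq => (h.pairing_eq hf hΩ hL hq).2) hp]
    exact dirD_comp_clm ((-ε) • ContinuousLinearMap.id ℝ ℝ) hd00 (X i p)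
  -- Both pairing identities hold on all of `U`, so they may be differentiated along X₁ and X₂. In
  -- the free coefficients, the resulting four equations combine into the three claims.
  have d10 := d1 0
  have d11 := d1 1
  have d20 := d2 0
  have d21 := d2 1
  rw [h.dirD_pairing hf hL hp, h.dirD_pairing hf hL hp] at d10 d11 d20 d21
  obtain ⟨r1, r2, r3, r4, r5, r6, r7, r8, r9, r10⟩ := h.relations hf hε hp
  simp only [pe1, pe2, hself, r1, r2, r3, r4, r5, r6, r7, r8, r9, r10,
    ← LinearMap.IsAlt.neg hΩ (ξ 0 p) (ξ 1 p)] at d10 d11 d20 d21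
  simp [hval] at d10 d11 d20 d21
  clear r1 r2 r3 r4 r5 r6 r7 r8 r9 r10
  rcases hε with rfl | rfl <;> refine ⟨?_, ?_, ?_⟩ <;> linarith

/-- The kernel of `H` in terms of the independent coefficients of the connection. -/
theorem matH_mulVec_eq_zero_iff (hf : IsImmersedSurface f) (hε : ε = 1 ∨ ε = -1)
    (h : IsAffineNormalFrame ε f vol U X ξ) {p : M} (hp : p ∈ U) (a b : ℝ) :
    matH ε f vol X ξ p *ᵥ ![a, b] = 0 ↔
    ((lam f vol X ξ 0 0 0 p - lam f vol X ξ 1 0 1 p) * a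
      + (-ε * lam f vol X ξ 0 0 1 p - lam f vol X ξ 1 0 0 p) * b = 0 ∧
    (lam f vol X ξ 0 1 0 p - lam f vol X ξ 1 1 1 p) * a
      + (-ε * lam f vol X ξ 0 1 1 p - lam f vol X ξ 1 1 0 p) * b = 0) ∧
    (2 * tau f vol X ξ 0 0 (X 1) p + ε * Gam f vol X ξ 0 0 1 p + Gam f vol X ξ 0 1 0 p) * a
      + 2 * ε * (Gam f vol X ξ 0 0 0 p + tau f vol X ξ 0 0 (X 0) p) * b = 0 ∧
    2 * (Gam f vol X ξ 0 0 0 p - tau f vol X ξ 0 0 (X 0) p) * a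
      + (2 * tau f vol X ξ 0 0 (X 1) p - ε * Gam f vol X ξ 0 0 1 p - Gam f vol X ξ 0 1 0 p) * b
        = 0 := by
  -- In the free coefficients the rows of F are twice the two linear forms that come from the
  -- Lagrangian condition.
  have hF : ∀ i, (matF ε f vol X ξ p *ᵥ ![a, b]) i
      = ![2 * ((2 * tau f vol X ξ 0 0 (X 1) p + ε * Gam f vol X ξ 0 0 1 p
          + Gam f vol X ξ 0 1 0 p) * a
          + 2 * ε * (Gam f vol X ξ 0 0 0 p + tau f vol X ξ 0 0 (X 0) p) * b),
        2 * (2 * (Gam f vol X ξ 0 0 0 p - tau f vol X ξ 0 0 (X 0) p) * a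
          + (2 * tau f vol X ξ 0 0 (X 1) p - ε * Gam f vol X ξ 0 0 1 p
          - Gam f vol X ξ 0 1 0 p) * b)] i := by
    obtain ⟨r1, r2, r3, r4, r5, r6, r7, r8, r9, r10⟩ := h.relations hf hε hp
    intro i
    fin_cases i <;>
    · simp only [matF, h.cubic_eq hf hp, r1, r2, r3, r4, r5, r6, r7, r8, r10]
      simp [hval, Matrix.mulVec, dotProduct, Fin.sum_univ_two]
      rcases hε with rfl | rfl <;> ring
  have hLr : ∀ i, (matL ε f vol X ξ p *ᵥ ![a, b]) i
      = ![(lam f vol X ξ 0 0 0 p - lam f vol X ξ 1 0 1 p) * a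
        + (-ε * lam f vol X ξ 0 0 1 p - lam f vol X ξ 1 0 0 p) * b,
        (lam f vol X ξ 0 1 0 p - lam f vol X ξ 1 1 1 p) * a
        + (-ε * lam f vol X ξ 0 1 1 p - lam f vol X ξ 1 1 0 p) * b] i := by
    intro i
    fin_cases i <;> simp [matL, Matrix.mulVec, dotProduct, Fin.sum_univ_two]
  rw [matH, Matrix.fromRows_mulVec, funext_iff, Sum.forall]
  simp only [Sum.elim_inl, Sum.elim_inr, hF, hLr, Fin.forall_fin_two, Pi.zero_apply,
    Matrix.cons_val_zero, Matrix.cons_val_one, mul_eq_zero, OfNat.ofNat_ne_zero, false_or]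

/-- The rows of F are the algebraic equations. The rows of L come from differentiating Ω(ξ₁, ξ₂) =
0, which holds throughout `U`. -/
theorem IsAffineNormalFrame.matH_mulVec_pairing (hf : IsImmersedSurface f) (hε : ε = 1 ∨ ε = -1)
    (h : IsAffineNormalFrame ε f vol U X ξ) {Ω : LinearMap.BilinForm ℝ R4} (hΩ : Ω.IsAlt)
    (hL : IsLagrangianOn Ω f U) {p : M} (hp : p ∈ U) :
    matH ε f vol X ξ p *ᵥ ![Ω (push f (X 0) p) (ξ 1 p), Ω (push f (X 0) p) (ξ 0 p)] = 0 := by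
  obtain ⟨a1, a2, a3⟩ := h.algebraic_equations hf hε hΩ hL hp
  obtain ⟨pe1, pe2⟩ := h.pairing_eq hf hΩ hL hp
  have hs : dirD (fun q => Ω (ξ 0 q) (ξ 1 q)) p = 0 :=
    dirD_eq_zero_of_const_on h.isOpen
      (fun q hq => (h.algebraic_equations hf hε hΩ hL hq).1) hp
  have d0 := h.dirD_xi_xi hΩ hp 0
  have d1 := h.dirD_xi_xi hΩ hp 1
  rw [hs, a1, pe1, pe2, zero_apply] at d0 d1
  rw [matH_mulVec_eq_zero_iff hf hε h hp]
  refine ⟨⟨?_, ?_⟩, a3, a2⟩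
  · linarith
  · linarith

/-- The derivative of the direction of `(Ω(X₁, ξ₂), Ω(X₁, ξ₁))`. -/
theorem IsAffineNormalFrame.wronskian_pairing (hf : IsImmersedSurface f) (hε : ε = 1 ∨ ε = -1)
    (h : IsAffineNormalFrame ε f vol U X ξ) {Ω : LinearMap.BilinForm ℝ R4} (hΩ : Ω.IsAlt)
    (hL : IsLagrangianOn Ω f U) {A B : M → ℝ}
    (hA : A = fun q => Ω (push f (X 0) q) (ξ 1 q)) (hB : B = fun q => Ω (push f (X 0) q) (ξ 0 q))
    {p : M} (hp : p ∈ U) :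
    A p * dirD B p (X 0 p) - B p * dirD A p (X 0 p)
      = -ε * fnG₁ ε f vol X ξ p * (A p ^ 2 + ε * B p ^ 2) ∧
    A p * dirD B p (X 1 p) - B p * dirD A p (X 1 p)
      = fnG₂ ε f vol X ξ p * (A p ^ 2 + ε * B p ^ 2) := by
  obtain ⟨a1, a2, a3⟩ := h.algebraic_equations hf hε hΩ hL hp
  obtain ⟨pe1, pe2⟩ := h.pairing_eq hf hΩ hL hp
  have hself : ∀ x, Ω x x = 0 := hΩ
  have hAp : Ω (push f (X 0) p) (ξ 1 p) = A p := by rw [hA]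
  have hBp : Ω (push f (X 0) p) (ξ 0 p) = B p := by rw [hB]
  have dA := fun i => h.dirD_pairing hf hL hp i 0 1
  have dB := fun i => h.dirD_pairing hf hL hp i 0 0
  rw [← hA] at dA
  rw [← hB] at dB
  rw [hAp, hBp] at a2 a3
  obtain ⟨r1, r2, r3, r4, r5, r6, r7, r8, r9, r10⟩ := h.relations hf hε hp
  simp only [dA, dB, pe1, pe2, a1, hself, hAp, hBp, fnG₁, fnG₂, r1, r2, r3, r4, r5, r6, r7, r8,
    r9]
  simp only [← LinearMap.IsAlt.neg hΩ (ξ 0 p) (ξ 1 p), a1]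
  simp [hval]
  clear r1 r2 r3 r4 r5 r6 r7 r8 r9 r10
  constructor
  -- The two sides differ by a combination, with coefficients ±A/2 and ±B/2, of the two equations of
  -- ker F.
  · rcases hε with rfl | rfl
    · linear_combination (A p * a3 - B p * a2) / 2
    · linear_combination (-A p * a3 - B p * a2) / 2
  · rcases hε with rfl | rfl <;> linear_combination (A p * a2 + B p * a3) / 2

/-- `A² + ε B²` is constant. -/
theorem IsAffineNormalFrame.norm_pairing (hf : IsImmersedSurface f)
    (h : IsAffineNormalFrame ε f vol U X ξ) {Ω : LinearMap.BilinForm ℝ R4} (hΩ : Ω.IsAlt)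
    (hL : IsLagrangianOn Ω f U) {c : ℝ} (hc : ∀ v, wedgeSq Ω v = c * vol v) {p : M} (hp : p ∈ U) :
    2 * (Ω (push f (X 0) p) (ξ 1 p) ^ 2 + ε * Ω (push f (X 0) p) (ξ 0 p) ^ 2) = c := by
  have h1 := hc (frame f X ξ p)
  rw [h.vol_eq p hp, mul_one] at h1
  obtain ⟨pe1, pe2⟩ := h.pairing_eq hf hΩ hL hp
  simp [wedgeSq, frame, hL.push_push hp, pe1, pe2] at h1
  rw [← h1]
  ring

theorem IsAffineNormalFrame.isLagrangianPlane_normalPlane (hf : IsImmersedSurface f)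
    (hε : ε = 1 ∨ ε = -1) (h : IsAffineNormalFrame ε f vol U X ξ) {Ω : LinearMap.BilinForm ℝ R4}
    (hΩ : Ω.IsAlt) (hL : IsLagrangianOn Ω f U) {p : M} (hp : p ∈ U) :
    IsLagrangianPlane Ω (normalPlane ξ p) := by
  have hself : ∀ x, Ω x x = 0 := hΩ
  constructor
  · have hli := linearIndependent_of_vol_ne_zero vol (h.vol_ne_zero hp)
    have hli2 : LinearIndependent ℝ (frame f X ξ p ∘ ![2, 3]) := hli.comp _ (by decide)
    have hr : Set.range (frame f X ξ p ∘ ![2, 3]) = {ξ 0 p, ξ 1 p} := by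
      have : frame f X ξ p ∘ ![2, 3] = ![ξ 0 p, ξ 1 p] := by
        funext i; fin_cases i <;> rfl
      rw [this, Matrix.range_cons_cons_empty]
    rw [normalPlane, ← hr, finrank_span_eq_card hli2]
    rfl
  · have hs := (h.algebraic_equations hf hε hΩ hL hp).1
    intro v hv w hw
    obtain ⟨a, b, rfl⟩ := Submodule.mem_span_pair.1 hv
    obtain ⟨c, d, rfl⟩ := Submodule.mem_span_pair.1 hw
    simp only [map_add, map_smul, LinearMap.add_apply, LinearMap.smul_apply, hself,
      ← LinearMap.IsAlt.neg hΩ (ξ 0 p) (ξ 1 p), hs]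
    simp

end LagrangianSurface

/-! ### Bookkeeping for derivatives of real functions. -/

section DirectionalDerivative

variable {M : Type*} [TopologicalSpace M] [ChartedSpace (EuclideanSpace ℝ (Fin 2)) M]

/-- `F` is differentiable at `p` with derivative `d` in the direction `v`. -/
def HasDirD (F : M → ℝ) (p : M) (v : TangentSpace (𝓡 2) p) (d : ℝ) : Prop :=
  MDifferentiableAt (𝓡 2) 𝓘(ℝ, ℝ) F p ∧ dirD F p v = d

variable {F G : M → ℝ} {p : M} {v : TangentSpace (𝓡 2) p} {a b : ℝ}

theorem hasDirD_of_mdifferentiableAt (h : MDifferentiableAt (𝓡 2) 𝓘(ℝ, ℝ) F p) :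
    HasDirD F p v (dirD F p v) := ⟨h, rfl⟩

theorem HasDirD.add (hF : HasDirD F p v a) (hG : HasDirD G p v b) :
    HasDirD (fun q => F q + G q) p v (a + b) :=
  ⟨mdifferentiableAt_add hF.1 hG.1, by rw [dirD_add hF.1 hG.1, hF.2, hG.2]⟩

theorem HasDirD.mul (hF : HasDirD F p v a) (hG : HasDirD G p v b) :
    HasDirD (fun q => F q * G q) p v (a * G p + F p * b) :=
  ⟨mdifferentiableAt_smul hF.1 hG.1, by rw [dirD_mul hF.1 hG.1, hF.2, hG.2]⟩

theorem HasDirD.comp {g : ℝ → ℝ} {g' : ℝ} (hg : HasDerivAt g g' (F p)) (hF : HasDirD F p v a) :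
    HasDirD (fun q => g (F q)) p v (g' * a) := by
  refine ⟨hg.differentiableAt.mdifferentiableAt.comp p hF.1, ?_⟩
  rw [dirD_comp hF.1 hg.differentiableAt, hF.2, hg.hasFDerivAt.fderiv]
  simp [mul_comm]

theorem HasDirD.const_mul (c : ℝ) (hF : HasDirD F p v a) :
    HasDirD (fun q => c * F q) p v (c * a) :=
  HasDirD.comp (g := fun x => c * x) (by simpa using (hasDerivAt_id (F p)).const_mul c) hF

theorem HasDirD.sub (hF : HasDirD F p v a) (hG : HasDirD G p v b) :
    HasDirD (fun q => F q - G q) p v (a - b) := by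
  have := hF.add (hG.const_mul (-1))
  simpa only [neg_mul, one_mul, ← sub_eq_add_neg] using this

theorem HasDirD.eq_zero_of_const_on {V : Set M} (hV : IsOpen V) (hp : p ∈ V) {c : ℝ}
    (hF : HasDirD F p v a) (h : ∀ q ∈ V, F q = c) : a = 0 := by
  rw [← hF.2, dirD_eq_zero_of_const_on hV h hp, zero_apply]

end DirectionalDerivative

/-! ### Existence and derivative of angles. -/

section Angle

variable {M : Type*} [TopologicalSpace M] [ChartedSpace (EuclideanSpace ℝ (Fin 2)) M]
  {ε : ℝ} {U : Set M} {A B : M → ℝ}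

theorem isAngle_arctan {a b : ℝ} (ha : a ≠ 0) : IsAngle 1 a b (Real.arctan (b / a)) := by
  refine ⟨Or.inl ha, Or.inl ⟨rfl, ?_⟩⟩
  rw [Real.sin_arctan, Real.cos_arctan]
  field_simp

theorem isAngle_pi_div_two_sub_arctan {a b : ℝ} (hb : b ≠ 0) :
    IsAngle 1 a b (Real.pi / 2 - Real.arctan (a / b)) := by
  refine ⟨Or.inr hb, Or.inl ⟨rfl, ?_⟩⟩
  rw [Real.sin_pi_div_two_sub, Real.cos_pi_div_two_sub, Real.sin_arctan, Real.cos_arctan]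
  field_simp

/-- Both relations tanh t = b/a and tanh t = a/b amount to e^{2t} = |(a + b)/(a - b)|, with positive
quotient in the first case and negative in the second. As `Real.log` ignores the sign, one formula
serves both. -/
theorem isAngle_log {a b : ℝ} (h : a ^ 2 - b ^ 2 ≠ 0) :
    IsAngle (-1) a b (Real.log ((a + b) / (a - b)) / 2) := by
  have h1 : a + b ≠ 0 := fun h0 => h (by linear_combination (a - b) * h0)
  have h2 : a - b ≠ 0 := fun h0 => h (by linear_combination (a + b) * h0)
  set t := Real.log ((a + b) / (a - b)) / 2 with ht
  have hE : Real.exp t * Real.exp t = |(a + b) / (a - b)| := by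
    rw [← Real.exp_add, ht, add_halves, Real.exp_log_eq_abs (div_ne_zero h1 h2)]
  have hm : Real.exp t * Real.exp (-t) = 1 := by rw [← Real.exp_add]; simp
  have hpos := Real.exp_pos t
  refine ⟨?_, Or.inr ⟨rfl, ?_⟩⟩
  · by_contra! hcon
    exact h1 (by rw [hcon.1, hcon.2, add_zero])
  · rw [Real.sinh_eq, Real.cosh_eq]
    rcases lt_or_ge 0 ((a + b) / (a - b)) with hs | hs
    · left
      rw [abs_of_pos hs, eq_div_iff h2] at hE
      apply mul_left_cancel₀ hpos.ne'
      linear_combination hE / 2 - (a + b) / 2 * hm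
    · right
      rw [abs_of_nonpos hs, ← neg_div, eq_div_iff h2] at hE
      apply mul_left_cancel₀ hpos.ne'
      linear_combination hE / 2 + (a + b) / 2 * hm

/-- For ε = 1 two arctangent formulas cover the regions A ≠ 0 and B ≠ 0; for ε = -1 the logarithm is
smooth on all of `U`. -/
theorem exists_angle (hε : ε = 1 ∨ ε = -1) (hU : IsOpen U)
    (hA : ContMDiffOn (𝓡 2) 𝓘(ℝ, ℝ) ∞ A U) (hB : ContMDiffOn (𝓡 2) 𝓘(ℝ, ℝ) ∞ B U)
    (hne : ∀ q ∈ U, A q ^ 2 + ε * B q ^ 2 ≠ 0) {p : M} (hp : p ∈ U) :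
    ∃ (V : Set M) (η : M → ℝ), IsOpen V ∧ p ∈ V ∧ V ⊆ U ∧
      ContMDiffOn (𝓡 2) 𝓘(ℝ, ℝ) ∞ η V ∧ ∀ q ∈ V, IsAngle ε (A q) (B q) (η q) := by
  have hopen : ∀ {F : M → ℝ}, ContMDiffOn (𝓡 2) 𝓘(ℝ, ℝ) ∞ F U → IsOpen (U ∩ F ⁻¹' {0}ᶜ) :=
    fun hF => hF.continuousOn.isOpen_inter_preimage hU isOpen_compl_singleton
  rcases hε with rfl | rfl
  · by_cases hA0 : A p = 0
    · have hB0 : B p ≠ 0 := fun hB0 => hne p hp (by rw [hA0, hB0]; ring)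
      refine ⟨U ∩ B ⁻¹' {0}ᶜ, fun q => Real.pi / 2 - Real.arctan (A q / B q), hopen hB,
        ⟨hp, hB0⟩, Set.inter_subset_left, ?_, fun q hq => isAngle_pi_div_two_sub_arctan hq.2⟩
      refine contMDiffOn_comp (g := fun x : ℝ × ℝ => Real.pi / 2 - Real.arctan (x.1 / x.2))
        ((hA.prodMk_space hB).mono Set.inter_subset_left) fun q hq => ?_
      exact contDiffAt_const.sub
        (contDiffAt_fst.div contDiffAt_snd (show (A q, B q).2 ≠ 0 from hq.2)).arctan
    · refine ⟨U ∩ A ⁻¹' {0}ᶜ, fun q => Real.arctan (B q / A q), hopen hA,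
        ⟨hp, hA0⟩, Set.inter_subset_left, ?_, fun q hq => isAngle_arctan hq.2⟩
      refine contMDiffOn_comp (g := fun x : ℝ × ℝ => Real.arctan (x.2 / x.1))
        ((hA.prodMk_space hB).mono Set.inter_subset_left) fun q hq => ?_
      exact (contDiffAt_snd.div contDiffAt_fst (show (A q, B q).1 ≠ 0 from hq.2)).arctan
  · have hne' : ∀ q ∈ U, A q ^ 2 - B q ^ 2 ≠ 0 := fun q hq h0 =>
      hne q hq (by linear_combination h0)
    refine ⟨U, fun q => Real.log ((A q + B q) / (A q - B q)) / 2, hU, hp, subset_rfl, ?_,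
      fun q hq => isAngle_log (hne' q hq)⟩
    refine contMDiffOn_comp
      (g := fun x : ℝ × ℝ => Real.log ((x.1 + x.2) / (x.1 - x.2)) / 2)
      (hA.prodMk_space hB) fun q hq => ?_
    have h1 : A q + B q ≠ 0 := fun h0 => hne' q hq (by linear_combination (A q - B q) * h0)
    have h2 : A q - B q ≠ 0 := fun h0 => hne' q hq (by linear_combination (A q + B q) * h0)
    exact (((contDiffAt_fst.add contDiffAt_snd).div (contDiffAt_fst.sub contDiffAt_snd) h2).log
      (div_ne_zero h1 h2)).div_const 2

/-- The derivative of a smooth angle. -/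
theorem dirD_angle {V : Set M} (hV : IsOpen V) {η : M → ℝ}
    {p : M} (hp : p ∈ V) (hA : MDifferentiableAt (𝓡 2) 𝓘(ℝ, ℝ) A p)
    (hB : MDifferentiableAt (𝓡 2) 𝓘(ℝ, ℝ) B p) (hη : MDifferentiableAt (𝓡 2) 𝓘(ℝ, ℝ) η p)
    (hang : ∀ q ∈ V, IsAngle ε (A q) (B q) (η q)) (v : TangentSpace (𝓡 2) p) :
    (A p ^ 2 + ε * B p ^ 2) * dirD η p v = A p * dirD B p v - B p * dirD A p v := by
  have hη' : HasDirD η p v (dirD η p v) := hasDirD_of_mdifferentiableAt hη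
  have hA' : HasDirD A p v (dirD A p v) := hasDirD_of_mdifferentiableAt hA
  have hB' : HasDirD B p v (dirD B p v) := hasDirD_of_mdifferentiableAt hB
  rcases (hang p hp).2 with ⟨rfl, h0⟩ | ⟨rfl, h0⟩
  · have hs := hη'.comp (Real.hasDerivAt_sin (η p))
    have hc := hη'.comp (Real.hasDerivAt_cos (η p))
    have hd := ((hA'.mul hs).sub (hB'.mul hc)).eq_zero_of_const_on hV hp (c := 0) fun q hq => by
      rcases (hang q hq).2 with h | h
      · rw [h.2, sub_self]
      · exact absurd h.1 (by norm_num)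
    have hsc := Real.sin_sq_add_cos_sq (η p)
    set s := Real.sin (η p)
    set c := Real.cos (η p)
    -- Polar form (A, B) = r(cos η, sin η) at the point; the differentiated relation is then
    -- multiplied by r.
    have e1 : A p = (A p * c + B p * s) * c := by linear_combination (-A p) * hsc + s * h0
    have e2 : B p = (A p * c + B p * s) * s := by linear_combination (-B p) * hsc - c * h0
    generalize A p * c + B p * s = r at e1 e2
    rw [e1, e2] at hd ⊢
    linear_combination r * hd
  · have hs := hη'.comp (Real.hasDerivAt_sinh (η p))
    have hc := hη'.comp (Real.hasDerivAt_cosh (η p))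
    -- Which of the two hyperbolic relations holds may depend on the point, but their product
    -- vanishes on all of `V` and can be differentiated. At `p` the factor that does not vanish is
    -- the radius r and can be cancelled.
    have hd := (((hA'.mul hs).sub (hB'.mul hc)).mul ((hA'.mul hc).sub (hB'.mul hs))
      ).eq_zero_of_const_on hV hp (c := 0) fun q hq => by
      rcases (hang q hq).2 with h | h
      · exact absurd h.1 (by norm_num)
      · rcases h.2 with h | h
        · rw [h, sub_self, zero_mul]
        · rw [h, sub_self, mul_zero]
    have hsc := Real.cosh_sq_sub_sinh_sq (η p)
    have hAB := (hang p hp).1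
    set s := Real.sinh (η p)
    set c := Real.cosh (η p)
    rcases h0 with h0 | h0
    · have e1 : A p = (A p * c - B p * s) * c := by linear_combination (-A p) * hsc - s * h0
      have e2 : B p = (A p * c - B p * s) * s := by linear_combination (-B p) * hsc - c * h0
      have hr : A p * c - B p * s ≠ 0 := fun hr => by
        rw [hr, zero_mul] at e1 e2
        rcases hAB with h | h <;> contradiction
      rw [h0, sub_self, zero_mul, add_zero, mul_eq_zero, or_iff_left hr] at hd
      generalize A p * c - B p * s = r at e1 e2
      rw [e1, e2] at hd ⊢
      linear_combination r * hd
    · have e1 : A p = -(A p * s - B p * c) * s := by linear_combination (-A p) * hsc + c * h0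
      have e2 : B p = -(A p * s - B p * c) * c := by linear_combination (-B p) * hsc + s * h0
      have hr : A p * s - B p * c ≠ 0 := fun hr => by
        rw [hr, neg_zero, zero_mul] at e1 e2
        rcases hAB with h | h <;> contradiction
      rw [h0, sub_self, mul_zero, zero_add, mul_eq_zero, or_iff_right hr] at hd
      generalize A p * s - B p * c = r at e1 e2
      rw [e1, e2] at hd ⊢
      linear_combination (-r) * hd

end Angle

/-! ### The angle of a Lagrangian surface. -/

section LagrangianSurface

variable {M : Type*} [TopologicalSpace M] [ChartedSpace (EuclideanSpace ℝ (Fin 2)) M]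
  [IsManifold (𝓡 2) ∞ M] {f : M → R4} {vol : R4 [⋀^Fin 4]→ₗ[ℝ] ℝ} {ε : ℝ}
  {U : Set M} {X : Fin 2 → VField M} {ξ : Fin 2 → M → R4}

theorem IsAffineNormalFrame.angle_of_lagrangian (hf : IsImmersedSurface f) (hε : ε = 1 ∨ ε = -1)
    (h : IsAffineNormalFrame ε f vol U X ξ) {Ω : LinearMap.BilinForm ℝ R4} (hΩ : Ω.IsAlt)
    (hL : IsLagrangianOn Ω f U) {c : ℝ} (hc0 : c ≠ 0) (hc : ∀ v, wedgeSq Ω v = c * vol v) :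
    ∃ A B : M → ℝ,
      (∀ p ∈ U, A p = Ω (push f (X 0) p) (ξ 1 p) ∧ A p = Ω (push f (X 1) p) (ξ 0 p) ∧
        B p = Ω (push f (X 0) p) (ξ 0 p) ∧ B p = -ε * Ω (push f (X 1) p) (ξ 1 p) ∧
        matH ε f vol X ξ p *ᵥ ![A p, B p] = 0) ∧
      (∀ p ∈ U, ∃ (V : Set M) (η : M → ℝ), IsOpen V ∧ p ∈ V ∧ V ⊆ U ∧
        ContMDiffOn (𝓡 2) 𝓘(ℝ, ℝ) ∞ η V ∧ ∀ q ∈ V, IsAngle ε (A q) (B q) (η q)) ∧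
      (∀ (V : Set M) (η : M → ℝ), IsOpen V → V ⊆ U → ContMDiffOn (𝓡 2) 𝓘(ℝ, ℝ) ∞ η V →
        (∀ q ∈ V, IsAngle ε (A q) (B q) (η q)) →
        ∀ q ∈ V, EtaEquations ε f vol X ξ η q) := by
  set A : M → ℝ := fun q => Ω (push f (X 0) q) (ξ 1 q) with hA
  set B : M → ℝ := fun q => Ω (push f (X 0) q) (ξ 0 q) with hB
  have hAs : ContMDiffOn (𝓡 2) 𝓘(ℝ, ℝ) ∞ A U :=
    contMDiffOn_bilin Ω (h.smooth_push hf 0) (h.smooth_ξ 1)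
  have hBs : ContMDiffOn (𝓡 2) 𝓘(ℝ, ℝ) ∞ B U :=
    contMDiffOn_bilin Ω (h.smooth_push hf 0) (h.smooth_ξ 0)
  have hne : ∀ q ∈ U, A q ^ 2 + ε * B q ^ 2 ≠ 0 := fun q hq h0 => by
    have := h.norm_pairing hf hΩ hL hc hq
    exact hc0 (by rw [← this]; change 2 * (A q ^ 2 + ε * B q ^ 2) = 0; rw [h0, mul_zero])
  refine ⟨A, B, fun p hp => ?_, fun p hp => exists_angle hε h.isOpen hAs hBs hne hp, ?_⟩
  · obtain ⟨e1, e2⟩ := h.pairing_eq hf hΩ hL hp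
    refine ⟨rfl, e1.symm, rfl, ?_, h.matH_mulVec_pairing hf hε hΩ hL hp⟩
    rw [e2]
    rcases hε with rfl | rfl <;> simp [hB]
  · intro V η hV hVU hη hang q hq
    have hd := dirD_angle hV hq (mdifferentiableAt_of_contMDiffOn h.isOpen hAs (hVU hq))
      (mdifferentiableAt_of_contMDiffOn h.isOpen hBs (hVU hq))
      (mdifferentiableAt_of_contMDiffOn hV hη hq) hang
    obtain ⟨w0, w1⟩ := h.wronskian_pairing hf hε hΩ hL hA hB (hVU hq)
    rw [← hd] at w0 w1
    have hN := hne q (hVU hq)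
    refine ⟨?_, ?_⟩
    · apply mul_left_cancel₀ hN
      linear_combination w0
    · apply mul_left_cancel₀ hN
      linear_combination w1

end LagrangianSurface

/-! ### The 2-form with prescribed pairings in a basis. -/

section PairForm

/-- The alternating form with `Ω(b₀, b₃) = Ω(b₁, b₂) = A`, `Ω(b₀, b₂) = B`, `Ω(b₁, b₃) = -ε B` and
`Ω(b₀, b₁) = Ω(b₂, b₃) = 0`, where `c` are the coordinates in the basis `b`. -/
def pairForm (ε A B : ℝ) (c : Fin 4 → R4 →ₗ[ℝ] ℝ) : LinearMap.BilinForm ℝ R4 :=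
  A • ((c 0).smulRight (c 3) - (c 3).smulRight (c 0) + (c 1).smulRight (c 2)
    - (c 2).smulRight (c 1))
  + B • ((c 0).smulRight (c 2) - (c 2).smulRight (c 0))
  - (ε * B) • ((c 1).smulRight (c 3) - (c 3).smulRight (c 1))

theorem pairForm_apply (ε A B : ℝ) (c : Fin 4 → R4 →ₗ[ℝ] ℝ) (v w : R4) :
    pairForm ε A B c v w =
      A * (c 0 v * c 3 w - c 3 v * c 0 w + (c 1 v * c 2 w - c 2 v * c 1 w))
      + B * (c 0 v * c 2 w - c 2 v * c 0 w - ε * (c 1 v * c 3 w - c 3 v * c 1 w)) := by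
  simp [pairForm]
  ring

/-- Pairing with the basis splits into two 2×2 systems, one for coordinates 2, 3 and one for 0, 1,
each with determinant ±(A² + εB²). -/
theorem isSymplectic_pairForm {ε A B : ℝ} {vol : R4 [⋀^Fin 4]→ₗ[ℝ] ℝ} {b : Fin 4 → R4}
    (hb : vol b ≠ 0) (hne : A ^ 2 + ε * B ^ 2 ≠ 0) :
    IsSymplectic (pairForm ε A B (coordL vol b)) := by
  have halt : (pairForm ε A B (coordL vol b)).IsAlt := fun v => by
    rw [pairForm_apply]; ring
  have hleft : ∀ v, (∀ w, pairForm ε A B (coordL vol b) v w = 0) → v = 0 := by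
    intro v hv
    have h0 := hv (b 0)
    have h1 := hv (b 1)
    have h2 := hv (b 2)
    have h3 := hv (b 3)
    simp [pairForm_apply, coordL_self vol hb] at h0 h1 h2 h3
    have hz : ∀ x : ℝ, (A ^ 2 + ε * B ^ 2) * x = 0 → x = 0 := fun x hx =>
      (mul_eq_zero.1 hx).resolve_left hne
    have z3 : coordL vol b 3 v = 0 := hz _ (by linear_combination (-A) * h0 + B * h1)
    have z2 : coordL vol b 2 v = 0 := hz _ (by linear_combination (-A) * h1 - ε * B * h0)
    have z1 : coordL vol b 1 v = 0 := hz _ (by linear_combination A * h2 - B * h3)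
    have z0 : coordL vol b 0 v = 0 := hz _ (by linear_combination A * h3 + ε * B * h2)
    rw [coordL_four vol b hb v, z0, z1, z2, z3]
    simp
  refine ⟨halt, hleft, fun v hv => hleft v fun w => ?_⟩
  rw [← LinearMap.IsAlt.neg halt, hv w, neg_zero]

theorem exists_isSymplectic {vol : R4 [⋀^Fin 4]→ₗ[ℝ] ℝ} (hvol : vol ≠ 0) :
    ∃ Ω : LinearMap.BilinForm ℝ R4, IsSymplectic Ω := by
  let e : Module.Basis (Fin 4) ℝ R4 := (EuclideanSpace.basisFun (Fin 4) ℝ).toBasis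
  have hv : vol e ≠ 0 := fun h => hvol (by rw [vol.eq_smul_basis_det e, h, zero_smul])
  exact ⟨_, isSymplectic_pairForm (ε := 1) (A := 1) (B := 0) hv (by norm_num)⟩

end PairForm

/-! ### Parallelism of the 2-form built from the frame. -/

section AdaptedFrame

variable {M : Type*} [TopologicalSpace M] [ChartedSpace (EuclideanSpace ℝ (Fin 2)) M]
  [IsManifold (𝓡 2) ∞ M] {f : M → R4} {vol : R4 [⋀^Fin 4]→ₗ[ℝ] ℝ} {ε : ℝ}
  {U : Set M} {X : Fin 2 → VField M} {ξ : Fin 2 → M → R4}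

theorem IsAffineNormalFrame.mono (h : IsAffineNormalFrame ε f vol U X ξ) {V : Set M}
    (hV : IsOpen V) (hVU : V ⊆ U) : IsAffineNormalFrame ε f vol V X ξ where
  isOpen := hV
  smooth_X i := ContMDiffOn.mono (h.smooth_X i) hVU
  smooth_ξ i := (h.smooth_ξ i).mono hVU
  discr_ne p hp := h.discr_ne p (hVU hp)
  metric₁₁ p hp := h.metric₁₁ p (hVU hp)
  metric₁₂ p hp := h.metric₁₂ p (hVU hp)
  metric₂₂ p hp := h.metric₂₂ p (hVU hp)
  vol_eq p hp := h.vol_eq p (hVU hp)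
  h1_11 p hp := h.h1_11 p (hVU hp)
  h1_12 p hp := h.h1_12 p (hVU hp)
  h1_22 p hp := h.h1_22 p (hVU hp)
  h2_11 p hp := h.h2_11 p (hVU hp)
  h2_12 p hp := h.h2_12 p (hVU hp)
  h2_22 p hp := h.h2_22 p (hVU hp)
  equiaffine₁ p hp := h.equiaffine₁ p (hVU hp)
  equiaffine₂ p hp := h.equiaffine₂ p (hVU hp)
  normal₁ p hp := h.normal₁ p (hVU hp)
  normal₂ p hp := h.normal₂ p (hVU hp)

/-- The derivative of the dual frame. -/
theorem IsAffineNormalFrame.dirD_fcoord (hf : IsImmersedSurface f)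
    (h : IsAffineNormalFrame ε f vol U X ξ) {p : M} (hp : p ∈ U) (i : Fin 2) (k : Fin 4) (v : R4) :
    HasDirD (fun q => fcoord f vol X ξ q k v) p (X i p)
      (-(fcoord f vol X ξ p 0 v * fcoord f vol X ξ p k (dirD (push f (X 0)) p (X i p))
        + fcoord f vol X ξ p 1 v * fcoord f vol X ξ p k (dirD (push f (X 1)) p (X i p))
        + fcoord f vol X ξ p 2 v * fcoord f vol X ξ p k (dirD (ξ 0) p (X i p))
        + fcoord f vol X ξ p 3 v * fcoord f vol X ξ p k (dirD (ξ 1) p (X i p)))) := by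
  have hv := h.vol_ne_zero hp
  have hd : ∀ k, MDifferentiableAt (𝓡 2) 𝓘(ℝ, ℝ) (fun q => fcoord f vol X ξ q k v) p := fun k =>
    mdifferentiableAt_of_contMDiffOn h.isOpen
      (h.smooth_fcoord hf k (v := fun _ => v) contMDiffOn_const) hp
  have hfr : ∀ a, MDifferentiableAt (𝓡 2) 𝓘(ℝ, R4) (fun q => frame f X ξ q a) p := fun a =>
    mdifferentiableAt_of_contMDiffOn h.isOpen (contMDiffOn_pi_space.1 (h.smooth_frame hf) a) hp
  refine ⟨hd k, ?_⟩
  -- The expansion of the fixed vector `v` in the moving frame is constant. Differentiating it and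
  -- taking the `k`-th coordinate at `p` isolates the derivative of that coordinate.
  have h0 : dirD (fun q => ∑ a, fcoord f vol X ξ q a v • frame f X ξ q a) p = 0 :=
    dirD_eq_zero_of_const_on h.isOpen
      (fun q hq => sum_coord_smul vol (frame f X ξ q) (h.vol_ne_zero hq) v) hp
  have h1 := (dirD_sum Finset.univ (F := fun a q => fcoord f vol X ξ q a v • frame f X ξ q a)
    (fun a _ => mdifferentiableAt_smul (hd a) (hfr a)) (X i p)).2
  rw [h0, zero_apply] at h1
  have h2 := congrArg (fcoord f vol X ξ p k) h1
  have hself : ∀ a, fcoord f vol X ξ p k (frame f X ξ p a) = if a = k then 1 else 0 :=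
    fun a => coordL_self vol hv k a
  simp only [map_zero, map_sum, dirD_smul (hd _) (hfr _), map_add, map_smul, hself,
    Finset.sum_add_distrib, smul_eq_mul, mul_ite, mul_one, mul_zero, Finset.sum_ite_eq',
    Finset.mem_univ, if_true] at h2
  rw [Fin.sum_univ_four] at h2
  rw [eq_neg_iff_add_eq_zero]
  exact h2.symm

/-- The form with coefficients `A`, `B` in the adapted frame is parallel. -/
theorem IsAffineNormalFrame.dirD_pairForm (hf : IsImmersedSurface f) (hε : ε = 1 ∨ ε = -1)
    (h : IsAffineNormalFrame ε f vol U X ξ) {A B : M → ℝ} {p : M} (hp : p ∈ U)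
    (hH : matH ε f vol X ξ p *ᵥ ![A p, B p] = 0)
    (hA0 : HasDirD A p (X 0 p) (B p * fnG₁ ε f vol X ξ p))
    (hA1 : HasDirD A p (X 1 p) (-ε * B p * fnG₂ ε f vol X ξ p))
    (hB0 : HasDirD B p (X 0 p) (-ε * A p * fnG₁ ε f vol X ξ p))
    (hB1 : HasDirD B p (X 1 p) (A p * fnG₂ ε f vol X ξ p)) (v w : R4) :
    dirD (fun q => pairForm ε (A q) (B q) (fcoord f vol X ξ q) v w) p = 0 := by
  obtain ⟨⟨l0, l1⟩, fb, fa⟩ := (matH_mulVec_eq_zero_iff hf hε h hp _ _).1 hH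
  obtain ⟨r1, r2, r3, r4, r5, r6, r7, r8, r9, r10⟩ := h.relations hf hε hp
  have T0 : ∀ j i, fcoord f vol X ξ p 0 (dirD (push f (X j)) p (X i p))
    = Gam f vol X ξ i j 0 p := fun _ _ => rfl
  have T1 : ∀ j i, fcoord f vol X ξ p 1 (dirD (push f (X j)) p (X i p))
    = Gam f vol X ξ i j 1 p := fun _ _ => rfl
  have T2 : ∀ j i, fcoord f vol X ξ p 2 (dirD (push f (X j)) p (X i p))
    = hval ε 0 i j := fun j i => h.hform_eq hf hp 0 i j
  have T3 : ∀ j i, fcoord f vol X ξ p 3 (dirD (push f (X j)) p (X i p))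
    = hval ε 1 i j := fun j i => h.hform_eq hf hp 1 i j
  have N0 : ∀ j i, fcoord f vol X ξ p 0 (dirD (ξ j) p (X i p))
    = -lam f vol X ξ j i 0 p := fun j i => fcoord_tangent_xi f vol X ξ i j 0 p
  have N1 : ∀ j i, fcoord f vol X ξ p 1 (dirD (ξ j) p (X i p))
    = -lam f vol X ξ j i 1 p := fun j i => fcoord_tangent_xi f vol X ξ i j 1 p
  have N2 : ∀ j i, fcoord f vol X ξ p 2 (dirD (ξ j) p (X i p))
    = tau f vol X ξ j 0 (X i) p := fun _ _ => rfl
  have N3 : ∀ j i, fcoord f vol X ξ p 3 (dirD (ξ j) p (X i p))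
    = tau f vol X ξ j 1 (X i) p := fun _ _ => rfl
  have hc := fun i k v => h.dirD_fcoord hf hp i k v
  have H000 : hval ε 0 0 0 = 1 := rfl
  have H001 : hval ε 0 0 1 = 0 := rfl
  have H010 : hval ε 0 1 0 = 0 := rfl
  have H011 : hval ε 0 1 1 = -ε := rfl
  have H100 : hval ε 1 0 0 = 0 := rfl
  have H101 : hval ε 1 0 1 = 1 := rfl
  have H110 : hval ε 1 1 0 = 1 := rfl
  have H111 : hval ε 1 1 1 = 0 := rfl
  have main := fun (i : Fin 2) (dA dB : ℝ) (hA : HasDirD A p (X i p) dA)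
      (hB : HasDirD B p (X i p) dB) =>
    (hA.mul ((((hc i 0 v).mul (hc i 3 w)).sub ((hc i 3 v).mul (hc i 0 w))).add
        (((hc i 1 v).mul (hc i 2 w)).sub ((hc i 2 v).mul (hc i 1 w))))).add
      (hB.mul ((((hc i 0 v).mul (hc i 2 w)).sub ((hc i 2 v).mul (hc i 0 w))).sub
        ((((hc i 1 v).mul (hc i 3 w)).sub ((hc i 3 v).mul (hc i 1 w))).const_mul ε)))
  have z0 : dirD (fun q => pairForm ε (A q) (B q) (fcoord f vol X ξ q) v w) p (X 0 p) = 0 := by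
    simp only [pairForm_apply]
    refine (main 0 _ _ hA0 hB0).2.trans ?_
    simp only [T0, T1, T2, T3, N0, N1, N2, N3, r2, r4, r6, r7, r10, H000, H001, H100, H101, fnG₁]
    clear main hc T0 T1 T2 T3 N0 N1 N2 N3 hA0 hA1 hB0 hB1 r1 r2 r3 r4 r5 r6 r7 r8 r9 r10
    generalize fcoord f vol X ξ p 0 v = v0
    generalize fcoord f vol X ξ p 1 v = v1
    generalize fcoord f vol X ξ p 2 v = v2
    generalize fcoord f vol X ξ p 3 v = v3
    generalize fcoord f vol X ξ p 0 w = w0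
    generalize fcoord f vol X ξ p 1 w = w1
    generalize fcoord f vol X ξ p 2 w = w2
    generalize fcoord f vol X ξ p 3 w = w3
    -- The 2-forms mixing tangent and normal coordinates are controlled by the rows of F, the purely
    -- normal one by a row of L; the purely tangential component vanishes identically.
    rcases hε with rfl | rfl
    · linear_combination (-(v0 * w3 - v3 * w0) / 2 + (v1 * w2 - v2 * w1) / 2) * fa
        + (-(v0 * w2 - v2 * w0) / 2 - (v1 * w3 - v3 * w1) / 2) * fb + (v2 * w3 - v3 * w2) * l0
    · linear_combination (-(v0 * w3 - v3 * w0) / 2 + (v1 * w2 - v2 * w1) / 2) * fa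
        + ((v0 * w2 - v2 * w0) / 2 - (v1 * w3 - v3 * w1) / 2) * fb + (v2 * w3 - v3 * w2) * l0
  have z1 : dirD (fun q => pairForm ε (A q) (B q) (fcoord f vol X ξ q) v w) p (X 1 p) = 0 := by
    simp only [pairForm_apply]
    refine (main 1 _ _ hA1 hB1).2.trans ?_
    simp only [T0, T1, T2, T3, N0, N1, N2, N3, r1, r2, r3, r5, r7, r8, r9, H010, H011, H110, H111,
      fnG₂]
    clear main hc T0 T1 T2 T3 N0 N1 N2 N3 hA0 hA1 hB0 hB1 r1 r2 r3 r4 r5 r6 r7 r8 r9 r10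
    generalize fcoord f vol X ξ p 0 v = v0
    generalize fcoord f vol X ξ p 1 v = v1
    generalize fcoord f vol X ξ p 2 v = v2
    generalize fcoord f vol X ξ p 3 v = v3
    generalize fcoord f vol X ξ p 0 w = w0
    generalize fcoord f vol X ξ p 1 w = w1
    generalize fcoord f vol X ξ p 2 w = w2
    generalize fcoord f vol X ξ p 3 w = w3
    rcases hε with rfl | rfl
    · linear_combination ((v0 * w3 - v3 * w0) / 2 - (v1 * w2 - v2 * w1) / 2) * fb
        + (-(v0 * w2 - v2 * w0) / 2 - (v1 * w3 - v3 * w1) / 2) * fa + (v2 * w3 - v3 * w2) * l1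
    · linear_combination ((v0 * w3 - v3 * w0) / 2 - (v1 * w2 - v2 * w1) / 2) * fb
        + (-(v0 * w2 - v2 * w0) / 2 + (v1 * w3 - v3 * w1) / 2) * fa + (v2 * w3 - v3 * w2) * l1
  ext z
  obtain ⟨a, b, rfl⟩ := exists_tangent_combination f vol X ξ (h.vol_ne_zero hp) z
  rw [map_add, map_smul, map_smul, z0, z1]
  simp

/-- A pair of functions with the derivatives prescribed by `(*)` and with values in `ker H` defines
a parallel symplectic form for which the surface is Lagrangian. -/
theorem IsAffineNormalFrame.exists_lagrangian_of_pair (hf : IsImmersedSurface f)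
    (hε : ε = 1 ∨ ε = -1)
    (h : IsAffineNormalFrame ε f vol U X ξ) {A B : M → ℝ}
    (hA : ContMDiffOn (𝓡 2) 𝓘(ℝ, ℝ) ∞ A U) (hB : ContMDiffOn (𝓡 2) 𝓘(ℝ, ℝ) ∞ B U)
    (hne : ∀ q ∈ U, A q ^ 2 + ε * B q ^ 2 ≠ 0)
    (hH : ∀ q ∈ U, matH ε f vol X ξ q *ᵥ ![A q, B q] = 0)
    (hA0 : ∀ q ∈ U, HasDirD A q (X 0 q) (B q * fnG₁ ε f vol X ξ q))
    (hA1 : ∀ q ∈ U, HasDirD A q (X 1 q) (-ε * B q * fnG₂ ε f vol X ξ q))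
    (hB0 : ∀ q ∈ U, HasDirD B q (X 0 q) (-ε * A q * fnG₁ ε f vol X ξ q))
    (hB1 : ∀ q ∈ U, HasDirD B q (X 1 q) (A q * fnG₂ ε f vol X ξ q)) {p : M} (hp : p ∈ U) :
    ∃ Ω : LinearMap.BilinForm ℝ R4, IsSymplectic Ω ∧
      ∃ V : Set M, IsOpen V ∧ p ∈ V ∧ V ⊆ U ∧ IsLagrangianOn Ω f V := by
  set P : M → LinearMap.BilinForm ℝ R4 :=
    fun q => pairForm ε (A q) (B q) (fcoord f vol X ξ q) with hP
  have hsm : ∀ v w, ContMDiffOn (𝓡 2) 𝓘(ℝ, ℝ) ∞ (fun q => P q v w) U := by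
    intro v w
    have hc := fun k (v : R4) => h.smooth_fcoord hf k (v := fun _ => v) contMDiffOn_const
    have hm : ∀ {F G : M → ℝ}, ContMDiffOn (𝓡 2) 𝓘(ℝ, ℝ) ∞ F U →
        ContMDiffOn (𝓡 2) 𝓘(ℝ, ℝ) ∞ G U → ContMDiffOn (𝓡 2) 𝓘(ℝ, ℝ) ∞ (fun q => F q * G q) U :=
      fun hF hG => hF.smul hG
    simp only [hP, pairForm_apply]
    exact (hm hA (((hm (hc 0 v) (hc 3 w)).sub (hm (hc 3 v) (hc 0 w))).add
        ((hm (hc 1 v) (hc 2 w)).sub (hm (hc 2 v) (hc 1 w))))).add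
      (hm hB (((hm (hc 0 v) (hc 2 w)).sub (hm (hc 2 v) (hc 0 w))).sub
        (hm contMDiffOn_const ((hm (hc 1 v) (hc 3 w)).sub (hm (hc 3 v) (hc 1 w))))))
  have hconst : ∀ v w, ∀ᶠ q in 𝓝 p, P q v w = P p v w := fun v w =>
    eventually_eq_of_dirD_eq_zero h.isOpen (hsm v w) (fun q hq => h.dirD_pairForm hf hε hq
      (hH q hq) (hA0 q hq) (hA1 q hq) (hB0 q hq) (hB1 q hq) v w) hp
  have hev : ∀ᶠ q in 𝓝 p, P q = P p := by
    let e : Module.Basis (Fin 4) ℝ R4 := (EuclideanSpace.basisFun (Fin 4) ℝ).toBasis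
    -- The neighbourhood of constancy depends on the two vectors; sixteen basis pairs suffice.
    have : ∀ᶠ q in 𝓝 p, ∀ i j, P q (e i) (e j) = P p (e i) (e j) :=
      Filter.eventually_all.2 fun i => Filter.eventually_all.2 fun j => hconst (e i) (e j)
    filter_upwards [this] with q hq
    exact e.ext fun i => e.ext fun j => hq i j
  obtain ⟨V, hVP, hV, hpV⟩ := eventually_nhds_iff.1 hev
  refine ⟨P p, isSymplectic_pairForm (h.vol_ne_zero hp) (hne p hp), V ∩ U, hV.inter h.isOpen,
    ⟨hpV, hp⟩, Set.inter_subset_right, fun q hq => ⟨?_, ?_⟩⟩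
  · have hinj : Function.Injective (dirD f q : TangentSpace (𝓡 2) q →ₗ[ℝ] R4) := hf.2 q
    rw [tangentPlane, LinearMap.finrank_range_of_inj hinj]
    change Module.finrank ℝ (EuclideanSpace ℝ (Fin 2)) = 2
    simp
  · rintro _ ⟨y, rfl⟩ _ ⟨z, rfl⟩
    have hv := h.vol_ne_zero hq.2
    -- Every term of `pairForm` contains a normal coordinate, and these vanish on tangent vectors.
    have h2 : ∀ k : Fin 4, k = 2 ∨ k = 3 → ∀ y, fcoord f vol X ξ q k (dirD f q y) = 0 := by
      intro k hk y
      obtain ⟨a, b, rfl⟩ := exists_tangent_combination f vol X ξ hv y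
      have := fun j => fcoord_push f vol X ξ hv k j
      have e0 := this 0
      have e1 := this 1
      rw [map_add, map_smul, map_smul, map_add, map_smul, map_smul]
      unfold push at e0 e1
      rw [e0, e1]
      rcases hk with rfl | rfl <;> simp
    rw [← hVP q hq.1]
    simp only [hP, pairForm_apply]
    simp [h2 2 (Or.inl rfl), h2 3 (Or.inr rfl)]

end AdaptedFrame

/-- Two independent kernel vectors in ℝ² would force `H = 0`, of rank 0. -/
theorem det_eq_zero_of_rank_eq_one {H : Matrix (Fin 2 ⊕ Fin 2) (Fin 2) ℝ} (hr : H.rank = 1)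
    {a b c d : ℝ} (h1 : H *ᵥ ![a, b] = 0) (h2 : H *ᵥ ![c, d] = 0) : a * d - b * c = 0 := by
  by_contra hne
  have hH : H = 0 := by
    ext i j
    have e1 := congrFun h1 i
    have e2 := congrFun h2 i
    simp [Matrix.mulVec, dotProduct, Fin.sum_univ_two] at e1 e2
    have z0 : H i 0 = 0 := (mul_eq_zero.1 (show (a * d - b * c) * H i 0 = 0 by
      linear_combination d * e1 - b * e2)).resolve_left hne
    have z1 : H i 1 = 0 := (mul_eq_zero.1 (show (a * d - b * c) * H i 1 = 0 by
      linear_combination a * e2 - c * e1)).resolve_left hne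
    fin_cases j
    · exact z0
    · exact z1
  rw [hH, Matrix.rank_zero] at hr
  exact zero_ne_one hr

/-! ### From an angle to a local symplectic form, and gluing. -/

section AdaptedFrame

variable {M : Type*} [TopologicalSpace M] [ChartedSpace (EuclideanSpace ℝ (Fin 2)) M]
  [IsManifold (𝓡 2) ∞ M] {f : M → R4} {vol : R4 [⋀^Fin 4]→ₗ[ℝ] ℝ} {ε : ℝ}
  {U : Set M} {X : Fin 2 → VField M} {ξ : Fin 2 → M → R4}

/-- Makes "not in the kernel" an open condition, as needed to separate the hyperbolic cases. -/
theorem IsAffineNormalFrame.continuousOn_matH (hf : IsImmersedSurface f)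
    (h : IsAffineNormalFrame ε f vol U X ξ) : ContinuousOn (matH ε f vol X ξ) U := by
  have hG := fun i j k => (h.smooth_Gam hf i j k).continuousOn
  have ht := fun i j k => (h.smooth_tau hf i j k).continuousOn
  have hl := fun i j k => (h.smooth_lam hf i j k).continuousOn
  have hC : ∀ m i a b, ContinuousOn (cubic f vol X ξ m (X i) (X a) (X b)) U := by
    intro m i a b
    refine ContinuousOn.congr ?_ fun q hq => h.cubic_eq hf hq m i a b
    exact (((((hG i a 0).mul continuousOn_const).add ((hG i a 1).mul continuousOn_const)).neg.sub
      (((hG i b 0).mul continuousOn_const).add ((hG i b 1).mul continuousOn_const))).add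
      ((ht 0 m i).mul continuousOn_const)).add ((ht 1 m i).mul continuousOn_const)
  have hc : ∀ c : ℝ, ContinuousOn (fun _ : M => c) U := fun _ => continuousOn_const
  refine continuousOn_pi.2 fun i => continuousOn_pi.2 fun j => ?_
  rcases i with i | i <;> fin_cases i <;> fin_cases j
  · exact (hl 0 0 0).sub (hl 1 0 1)
  · exact ((hc (-ε)).mul (hl 0 0 1)).sub (hl 1 0 0)
  · exact (hl 0 1 0).sub (hl 1 1 1)
  · exact ((hc (-ε)).mul (hl 0 1 1)).sub (hl 1 1 0)
  · exact ((hc 3).mul (hC 0 0 0 1)).sub ((hc ε).mul (hC 0 1 1 1))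
  · exact ((hc ε).mul (hC 0 0 0 0)).sub ((hc 3).mul (hC 0 0 1 1))
  · exact ((hc 3).mul (hC 1 0 0 1)).sub ((hc ε).mul (hC 1 1 1 1))
  · exact ((hc ε).mul (hC 1 0 0 0)).sub ((hc 3).mul (hC 1 0 1 1))

theorem IsAffineNormalFrame.continuousOn_matH_mulVec (hf : IsImmersedSurface f)
    (h : IsAffineNormalFrame ε f vol U X ξ) {a b : M → ℝ} (ha : ContinuousOn a U)
    (hb : ContinuousOn b U) :
    ContinuousOn (fun q => matH ε f vol X ξ q *ᵥ ![a q, b q]) U := by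
  have hH := h.continuousOn_matH hf
  refine continuousOn_pi.2 fun i => ?_
  simp only [Matrix.mulVec, dotProduct, Fin.sum_univ_two]
  have hij := fun j => continuousOn_pi.1 (continuousOn_pi.1 hH i) j
  exact ((hij 0).mul ha).add ((hij 1).mul hb)

/-- A pair of functions of an angle that satisfies `(*)`, with values in `ker H`, defines a parallel
symplectic form for which the surface is Lagrangian. -/
theorem IsAffineNormalFrame.exists_lagrangian_of_angle_functions (hf : IsImmersedSurface f)
    (hε : ε = 1 ∨ ε = -1) (h : IsAffineNormalFrame ε f vol U X ξ) {η : M → ℝ}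
    (hη : ContMDiffOn (𝓡 2) 𝓘(ℝ, ℝ) ∞ η U) (heq : ∀ q ∈ U, EtaEquations ε f vol X ξ η q)
    {C S : ℝ → ℝ} (hCs : ContDiff ℝ ∞ C) (hSs : ContDiff ℝ ∞ S)
    (hC : ∀ t, HasDerivAt C (-ε * S t) t) (hS : ∀ t, HasDerivAt S (C t) t)
    (hne : ∀ t, C t ^ 2 + ε * S t ^ 2 ≠ 0)
    (hH : ∀ q ∈ U, matH ε f vol X ξ q *ᵥ ![C (η q), S (η q)] = 0) {p : M} (hp : p ∈ U) :
    ∃ Ω : LinearMap.BilinForm ℝ R4, IsSymplectic Ω ∧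
      ∃ V : Set M, IsOpen V ∧ p ∈ V ∧ V ⊆ U ∧ IsLagrangianOn Ω f V := by
  have hd : ∀ q ∈ U, HasDirD η q (X 0 q) (-ε * fnG₁ ε f vol X ξ q) ∧
      HasDirD η q (X 1 q) (fnG₂ ε f vol X ξ q) := fun q hq => by
    have hm := mdifferentiableAt_of_contMDiffOn h.isOpen hη hq
    obtain ⟨e1, e2⟩ := heq q hq
    exact ⟨⟨hm, by linear_combination e1⟩, ⟨hm, by linear_combination e2⟩⟩
  have hεε : ε * ε = 1 := by rcases hε with rfl | rfl <;> norm_num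
  refine h.exists_lagrangian_of_pair hf hε (A := fun q => C (η q)) (B := fun q => S (η q))
    (contMDiffOn_comp hη fun _ _ => hCs.contDiffAt) (contMDiffOn_comp hη fun _ _ => hSs.contDiffAt)
    (fun q _ => hne _) hH ?_ ?_ ?_ ?_ hp
  · intro q hq
    convert (hd q hq).1.comp (hC (η q)) using 1
    linear_combination (-S (η q) * fnG₁ ε f vol X ξ q) * hεε
  · intro q hq
    exact (hd q hq).2.comp (hC (η q))
  · intro q hq
    convert (hd q hq).1.comp (hS (η q)) using 1
    ring
  · intro q hq
    exact (hd q hq).2.comp (hS (η q))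

/-- Only η is smooth here; `A` and `B` are arbitrary functions. They are replaced by the circular or
hyperbolic functions of η, which span the same line and hence also lie in ker H. -/
theorem IsAffineNormalFrame.exists_local_lagrangian (hf : IsImmersedSurface f)
    (hε : ε = 1 ∨ ε = -1) (h : IsAffineNormalFrame ε f vol U X ξ) {A B η : M → ℝ}
    (hH : ∀ q ∈ U, (matH ε f vol X ξ q).rank = 1 ∧ matH ε f vol X ξ q *ᵥ ![A q, B q] = 0)
    (hη : ContMDiffOn (𝓡 2) 𝓘(ℝ, ℝ) ∞ η U)
    (hang : ∀ q ∈ U, IsAngle ε (A q) (B q) (η q) ∧ EtaEquations ε f vol X ξ η q)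
    {p : M} (hp : p ∈ U) :
    ∃ Ω : LinearMap.BilinForm ℝ R4, IsSymplectic Ω ∧
      ∃ V : Set M, IsOpen V ∧ p ∈ V ∧ V ⊆ U ∧ IsLagrangianOn Ω f V := by
  have hscale : ∀ q {r a b : ℝ}, (A q ≠ 0 ∨ B q ≠ 0) → A q = r * a → B q = r * b →
      matH ε f vol X ξ q *ᵥ ![A q, B q] = 0 → matH ε f vol X ξ q *ᵥ ![a, b] = 0 := by
    intro q r a b hAB h1 h2 h3
    have hr : r ≠ 0 := fun hr => by
      rw [hr, zero_mul] at h1 h2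
      rcases hAB with h | h <;> contradiction
    have h4 : ![A q, B q] = r • ![a, b] := by rw [h1, h2]; simp
    rw [h4, Matrix.mulVec_smul] at h3
    exact (smul_eq_zero.1 h3).resolve_left hr
  rcases hε with rfl | rfl
  · refine h.exists_lagrangian_of_angle_functions hf (Or.inl rfl) hη (fun q hq => (hang q hq).2)
      Real.contDiff_cos Real.contDiff_sin (fun t => ?_) Real.hasDerivAt_sin (fun t => ?_) ?_ hp
    · simpa using Real.hasDerivAt_cos t
    · rw [one_mul, Real.cos_sq_add_sin_sq]
      exact one_ne_zero
    · intro q hq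
      obtain ⟨hAB, hA⟩ := (hang q hq).1
      have hA' : A q * Real.sin (η q) = B q * Real.cos (η q) := by
        rcases hA with hA | hA
        · exact hA.2
        · exact absurd hA.1 (by norm_num)
      have hsc := Real.sin_sq_add_cos_sq (η q)
      refine hscale q (r := A q * Real.cos (η q) + B q * Real.sin (η q)) hAB ?_ ?_ (hH q hq).2
      · linear_combination (-A q) * hsc + Real.sin (η q) * hA'
      · linear_combination (-B q) * hsc - Real.cos (η q) * hA'
  · have hcase : ∀ q ∈ U, matH (-1) f vol X ξ q *ᵥ ![Real.cosh (η q), Real.sinh (η q)] = 0 ∨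
        matH (-1) f vol X ξ q *ᵥ ![Real.sinh (η q), Real.cosh (η q)] = 0 := by
      intro q hq
      obtain ⟨hAB, hA⟩ := (hang q hq).1
      have hsc := Real.cosh_sq_sub_sinh_sq (η q)
      rcases hA with hA | ⟨-, hA | hA⟩
      · exact absurd hA.1 (by norm_num)
      · left
        refine hscale q (r := A q * Real.cosh (η q) - B q * Real.sinh (η q)) hAB ?_ ?_ (hH q hq).2
        · linear_combination (-A q) * hsc - Real.sinh (η q) * hA
        · linear_combination (-B q) * hsc - Real.cosh (η q) * hA
      · right
        refine hscale q (r := B q * Real.cosh (η q) - A q * Real.sinh (η q)) hAB ?_ ?_ (hH q hq).2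
        · linear_combination (-A q) * hsc + Real.cosh (η q) * hA
        · linear_combination (-B q) * hsc + Real.sinh (η q) * hA
    -- The two candidate directions have determinant cosh² - sinh² = 1, so a one-dimensional kernel
    -- contains only one of them.
    have hnot : ∀ q ∈ U, ¬(matH (-1) f vol X ξ q *ᵥ ![Real.cosh (η q), Real.sinh (η q)] = 0 ∧
        matH (-1) f vol X ξ q *ᵥ ![Real.sinh (η q), Real.cosh (η q)] = 0) := by
      rintro q hq ⟨h1, h2⟩
      have := det_eq_zero_of_rank_eq_one (hH q hq).1 h1 h2
      have hsc := Real.cosh_sq_sub_sinh_sq (η q)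
      exact one_ne_zero (by linear_combination this - hsc : (1 : ℝ) = 0)
    have hch : ContinuousOn (fun q => Real.cosh (η q)) U :=
      Real.continuous_cosh.comp_continuousOn hη.continuousOn
    have hsh : ContinuousOn (fun q => Real.sinh (η q)) U :=
      Real.continuous_sinh.comp_continuousOn hη.continuousOn
    -- Where one pair is outside the kernel the other is inside; this region is open, so the same
    -- pair works near `p`.
    have hopen : ∀ {a b : M → ℝ}, ContinuousOn a U → ContinuousOn b U →
        IsOpen (U ∩ {q | matH (-1) f vol X ξ q *ᵥ ![a q, b q] ≠ 0}) := fun ha hb =>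
      (h.continuousOn_matH_mulVec hf ha hb).isOpen_inter_preimage h.isOpen isOpen_compl_singleton
    rcases hcase p hp with hp1 | hp1
    · obtain ⟨Ω, hΩ, V, hV, hpV, hVU, hL⟩ :=
        (h.mono (hopen hsh hch) Set.inter_subset_left).exists_lagrangian_of_angle_functions hf
          (Or.inr rfl) (hη.mono Set.inter_subset_left) (fun q hq => (hang q hq.1).2)
          Real.contDiff_cosh Real.contDiff_sinh
          (fun t => by simpa using Real.hasDerivAt_cosh t) Real.hasDerivAt_sinh
          (fun t => by
            rw [neg_one_mul, ← sub_eq_add_neg, Real.cosh_sq_sub_sinh_sq]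
            exact one_ne_zero)
          (fun q hq => (hcase q hq.1).resolve_right hq.2)
          ⟨hp, fun h2 => hnot p hp ⟨hp1, h2⟩⟩
      exact ⟨Ω, hΩ, V, hV, hpV, hVU.trans Set.inter_subset_left, hL⟩
    · obtain ⟨Ω, hΩ, V, hV, hpV, hVU, hL⟩ :=
        (h.mono (hopen hch hsh) Set.inter_subset_left).exists_lagrangian_of_angle_functions hf
          (Or.inr rfl) (hη.mono Set.inter_subset_left) (fun q hq => (hang q hq.1).2)
          Real.contDiff_sinh Real.contDiff_cosh
          (fun t => by simpa using Real.hasDerivAt_sinh t) Real.hasDerivAt_cosh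
          (fun t => by
            have := Real.cosh_sq_sub_sinh_sq t
            intro h0
            exact one_ne_zero (by linear_combination -this - h0 : (1 : ℝ) = 0))
          (fun q hq => (hcase q hq.1).resolve_left hq.2)
          ⟨hp, fun h2 => hnot p hp ⟨h2, hp1⟩⟩
      exact ⟨Ω, hΩ, V, hV, hpV, hVU.trans Set.inter_subset_left, hL⟩

/-- A Lagrangian surface with `rank H = 1` determines its symplectic form up to a factor. -/
theorem IsAffineNormalFrame.exists_smul_eq (hf : IsImmersedSurface f) (hvol : vol ≠ 0)
    (hε : ε = 1 ∨ ε = -1) (h : IsAffineNormalFrame ε f vol U X ξ)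
    {Ω Ω' : LinearMap.BilinForm ℝ R4} (hΩ : IsSymplectic Ω) (hΩ' : IsSymplectic Ω')
    (hL : IsLagrangianOn Ω f U) (hL' : IsLagrangianOn Ω' f U) {p : M} (hp : p ∈ U)
    (hr : (matH ε f vol X ξ p).rank = 1) : ∃ k : ℝ, Ω = k • Ω' := by
  obtain ⟨c, hc0, hc⟩ := exists_wedgeSq_eq hvol hΩ'
  have hn := h.norm_pairing hf hΩ'.1 hL' hc hp
  have hd := det_eq_zero_of_rank_eq_one hr (h.matH_mulVec_pairing hf hε hΩ.1 hL hp)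
    (h.matH_mulVec_pairing hf hε hΩ'.1 hL' hp)
  obtain ⟨e1, e2⟩ := h.pairing_eq hf hΩ.1 hL hp
  obtain ⟨e1', e2'⟩ := h.pairing_eq hf hΩ'.1 hL' hp
  have s1 := (h.algebraic_equations hf hε hΩ.1 hL hp).1
  have s1' := (h.algebraic_equations hf hε hΩ'.1 hL' hp).1
  set a := Ω (push f (X 0) p) (ξ 1 p)
  set b := Ω (push f (X 0) p) (ξ 0 p)
  set a' := Ω' (push f (X 0) p) (ξ 1 p)
  set b' := Ω' (push f (X 0) p) (ξ 0 p)
  have hn' : a' ^ 2 + ε * b' ^ 2 ≠ 0 := fun h0 => hc0 (by rw [← hn, h0, mul_zero])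
  -- Both vectors lie in the line ker H, and the primed one is nonzero because `a' ^ 2 + ε * b' ^ 2
  -- ≠ 0`.
  have hk : ∃ k : ℝ, a = k * a' ∧ b = k * b' := by
    by_cases ha : a' = 0
    · have hb : b' ≠ 0 := fun hb => hn' (by rw [ha, hb]; ring)
      refine ⟨b / b', ?_, by field_simp⟩
      rw [ha, mul_zero]
      exact (mul_eq_zero.1 (by linear_combination hd + b * ha : a * b' = 0)).resolve_right hb
    · refine ⟨a / a', by field_simp, ?_⟩
      field_simp
      linear_combination -hd
  obtain ⟨k, hka, hkb⟩ := hk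
  refine ⟨k, ?_⟩
  have hself : ∀ x, Ω x x = 0 := hΩ.1
  have hself' : ∀ x, Ω' x x = 0 := hΩ'.1
  -- All pairings of the frame are zero or determined by the two numbers just compared, so one point
  -- fixes the whole form.
  have hlt : ∀ i j : Fin 4, i < j → Ω (frame f X ξ p i) (frame f X ξ p j)
      = k * Ω' (frame f X ξ p i) (frame f X ξ p j) := by
    intro i j hij
    fin_cases i <;> fin_cases j <;> first | exact absurd hij (by decide) | skip
    · change Ω (push f (X 0) p) (push f (X 1) p) = k * Ω' (push f (X 0) p) (push f (X 1) p)
      rw [hL.push_push hp, hL'.push_push hp, mul_zero]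
    · exact hkb
    · exact hka
    · exact e1.trans (hka.trans (by rw [← e1']; rfl))
    · change Ω (push f (X 1) p) (ξ 1 p) = k * Ω' (push f (X 1) p) (ξ 1 p)
      rw [e2, e2', hkb]
      ring
    · change Ω (ξ 0 p) (ξ 1 p) = k * Ω' (ξ 0 p) (ξ 1 p)
      rw [s1, s1', mul_zero]
  have hall : ∀ i j : Fin 4, Ω (frame f X ξ p i) (frame f X ξ p j)
      = k * Ω' (frame f X ξ p i) (frame f X ξ p j) := by
    intro i j
    rcases lt_trichotomy i j with hij | rfl | hij
    · exact hlt i j hij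
    · rw [hself, hself', mul_zero]
    · rw [← LinearMap.IsAlt.neg hΩ.1, ← LinearMap.IsAlt.neg hΩ'.1, hlt j i hij]
      ring
  have hli := linearIndependent_of_vol_ne_zero vol (h.vol_ne_zero hp)
  let e : Module.Basis (Fin 4) ℝ R4 := basisOfLinearIndependentOfCardEqFinrank hli (by simp)
  have he : ∀ i, e i = frame f X ξ p i := fun i => by simp [e]
  refine e.ext fun i => e.ext fun j => ?_
  rw [he, he, hall]
  rfl

/-- Local Lagrangian conditions glue over a connected set. -/
theorem exists_lagrangian_of_local (hf : IsImmersedSurface f) (hvol : vol ≠ 0)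
    (hε : ε = 1 ∨ ε = -1) {W : Set M} (hWc : IsPreconnected W)
    (hloc : ∀ p ∈ W, ∃ (U : Set M) (X : Fin 2 → VField M) (ξ : Fin 2 → M → R4),
      IsAffineNormalFrame ε f vol U X ξ ∧ (∀ q ∈ U, (matH ε f vol X ξ q).rank = 1) ∧
      ∃ Ω : LinearMap.BilinForm ℝ R4, IsSymplectic Ω ∧
        ∃ V : Set M, IsOpen V ∧ p ∈ V ∧ V ⊆ U ∧ IsLagrangianOn Ω f V) :
    ∃ Ω : LinearMap.BilinForm ℝ R4, IsSymplectic Ω ∧ IsLagrangianOn Ω f W := by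
  rcases W.eq_empty_or_nonempty with rfl | ⟨p₀, hp₀⟩
  · obtain ⟨Ω, hΩ⟩ := exists_isSymplectic hvol
    exact ⟨Ω, hΩ, fun p hp => absurd hp (Set.notMem_empty p)⟩
  obtain ⟨-, -, -, -, -, Ω, hΩ, V₀, hV₀, hpV₀, -, hL₀⟩ := hloc p₀ hp₀
  refine ⟨Ω, hΩ, ?_⟩
  -- Connectedness argument for a fixed `Ω`: this set is open, meets `W`, and is shown to be closed
  -- relative to `W`.
  set S : Set M := {q | ∃ V : Set M, IsOpen V ∧ q ∈ V ∧ IsLagrangianOn Ω f V} with hS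
  have hSopen : IsOpen S := isOpen_iff_forall_mem_open.2 fun q ⟨V, hV, hqV, hL⟩ =>
    ⟨V, fun r hr => ⟨V, hV, hr, hL⟩, hV, hqV⟩
  have hsub : W ⊆ S := by
    refine hWc.subset_of_closure_inter_subset hSopen ⟨p₀, hp₀, V₀, hV₀, hpV₀, hL₀⟩ ?_
    rintro q ⟨hqS, hqW⟩
    obtain ⟨U, X, ξ, h, hr, Ω', hΩ', V, hV, hqV, hVU, hL'⟩ := hloc q hqW
    obtain ⟨r, hrV, V₁, hV₁, hrV₁, hL₁⟩ := mem_closure_iff.1 hqS V hV hqV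
    -- On the overlap near `r` the surface is Lagrangian for both forms, so they are proportional.
    -- Being constant, they are proportional everywhere, and `Ω` inherits the Lagrangian property on
    -- all of `V`.
    obtain ⟨k, rfl⟩ := (h.mono (hV.inter hV₁) (Set.inter_subset_left.trans hVU)).exists_smul_eq hf
      hvol hε hΩ hΩ' (fun x hx => hL₁ x hx.2) (fun x hx => hL' x hx.1) ⟨hrV, hrV₁⟩ (hr r (hVU hrV))
    refine ⟨V, hV, hqV, fun x hx => ⟨(hL' x hx).1, fun v hv w hw => ?_⟩⟩
    rw [LinearMap.smul_apply, LinearMap.smul_apply, (hL' x hx).2 v hv w hw, smul_zero]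
  intro p hp
  obtain ⟨V, -, hpV, hL⟩ := hsub hp
  exact hL p hpV

end AdaptedFrame

end AffineSurface

end

theorem theorem1 {M : Type*} [TopologicalSpace M] [ChartedSpace (EuclideanSpace ℝ (Fin 2)) M]
    [IsManifold (𝓡 2) ∞ M] (f : M → AffineSurface.R4) (hf : AffineSurface.IsImmersedSurface f)
    (vol : AffineSurface.R4 [⋀^Fin 4]→ₗ[ℝ] ℝ) (hvol : vol ≠ 0) (ε : ℝ) (hε : ε = 1 ∨ ε = -1) :
    (∀ (U : Set M) (X : Fin 2 → AffineSurface.VField M) (ξ : Fin 2 → M → AffineSurface.R4),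
      AffineSurface.IsAffineNormalFrame ε f vol U X ξ →
      ∀ Ω : LinearMap.BilinForm ℝ AffineSurface.R4, AffineSurface.IsSymplectic Ω →
      AffineSurface.IsLagrangianOn Ω f U →
      (∀ p ∈ U, AffineSurface.IsLagrangianPlane Ω (AffineSurface.normalPlane ξ p)) ∧
      (∃ c : ℝ, c ≠ 0 ∧ ∀ v, AffineSurface.wedgeSq Ω v = c * vol v) ∧
      ∃ A B : M → ℝ,
        (∀ p ∈ U, A p = Ω (AffineSurface.push f (X 0) p) (ξ 1 p) ∧
          A p = Ω (AffineSurface.push f (X 1) p) (ξ 0 p) ∧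
          B p = Ω (AffineSurface.push f (X 0) p) (ξ 0 p) ∧
          B p = -ε * Ω (AffineSurface.push f (X 1) p) (ξ 1 p) ∧
          AffineSurface.matH ε f vol X ξ p *ᵥ ![A p, B p] = 0) ∧
        (∀ p ∈ U, ∃ (V : Set M) (η : M → ℝ), IsOpen V ∧ p ∈ V ∧ V ⊆ U ∧
          ContMDiffOn (𝓡 2) 𝓘(ℝ, ℝ) ∞ η V ∧
          ∀ q ∈ V, AffineSurface.IsAngle ε (A q) (B q) (η q)) ∧
        (∀ (V : Set M) (η : M → ℝ), IsOpen V → V ⊆ U → ContMDiffOn (𝓡 2) 𝓘(ℝ, ℝ) ∞ η V →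
          (∀ q ∈ V, AffineSurface.IsAngle ε (A q) (B q) (η q)) →
          ∀ q ∈ V, AffineSurface.EtaEquations ε f vol X ξ η q)) ∧
    (∀ W : Set M, IsOpen W → IsPreconnected W →
      (∀ p ∈ W, ∃ (U : Set M) (X : Fin 2 → AffineSurface.VField M)
        (ξ : Fin 2 → M → AffineSurface.R4) (A B η : M → ℝ),
        p ∈ U ∧ AffineSurface.IsAffineNormalFrame ε f vol U X ξ ∧
        (∀ q ∈ U, (AffineSurface.matH ε f vol X ξ q).rank = 1 ∧
          AffineSurface.matH ε f vol X ξ q *ᵥ ![A q, B q] = 0) ∧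
        ContMDiffOn (𝓡 2) 𝓘(ℝ, ℝ) ∞ η U ∧
        ∀ q ∈ U, AffineSurface.IsAngle ε (A q) (B q) (η q) ∧
          AffineSurface.EtaEquations ε f vol X ξ η q) →
      ∃ Ω : LinearMap.BilinForm ℝ AffineSurface.R4,
        AffineSurface.IsSymplectic Ω ∧ AffineSurface.IsLagrangianOn Ω f W) := by
  refine ⟨fun U X ξ h Ω hΩ hL => ?_, fun W _ hWc hloc => ?_⟩
  · obtain ⟨c, hc0, hc⟩ := AffineSurface.exists_wedgeSq_eq hvol hΩ
    exact ⟨fun p hp => h.isLagrangianPlane_normalPlane hf hε hΩ.1 hL hp, ⟨c, hc0, hc⟩,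
      h.angle_of_lagrangian hf hε hΩ.1 hL hc0 hc⟩
  · refine AffineSurface.exists_lagrangian_of_local hf hvol hε hWc fun p hp => ?_
    obtain ⟨U, X, ξ, A, B, η, hpU, h, hH, hη, hang⟩ := hloc p hp
    exact ⟨U, X, ξ, h, fun q hq => (hH q hq).1, h.exists_local_lagrangian hf hε hH hη hang hpU⟩
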